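/- **Setting.** Times are pairs $\mathbf t=(\mathbf t^1,\mathbf t^2)$ of absolutely summable complex sequences $\mathbf t^i=(t^i_n)_{n\ge 1}$ (a Banach space, $\ell^1\times\ell^1$), $\partial^i_n=\partial/\partial t^i_n$, and $S^i_0(z)=\sum_{n\ge1}t^i_nz^{n-1}$ for $|z|\le 1$. Write $x=t^1_1$, $y=t^2_1$, $t=t^1_2$, $\tilde t=t^2_2$ and $\{F,G\}=F_xG_y-F_yG_x$. Let $U$ be an open set of times. Let $S^i=S^i_0+\widetilde S^i$, $i=1,2$, be a family, over $\mathbf t\in U$, of solutions of the Hamiltonian $\bar\partial$-problem with support in the unit disc, $$\bar\partial S^1=\frac{\partial W}{\partial S^2},\qquad \bar\partial S^2=-\frac{\partial W}{\partial S^1}\qquad(|z|<1),$$ where the potential $W(z,\bar z;S^1,S^2)$ is holomorphic in $(S^1,S^2)$ at the values taken by the solution. For each $\mathbf t\in U$, $\widetilde S^i(\cdot,\mathbf t)$ is continuous on $\mathbb C$, analytic for $|z|>1$ and tends to $0$ as $z\to\infty$. Moreover $\widetilde S^i(\cdot,\mathbf t)$ depends holomorphically on $\mathbf t\in U$ (with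 respect to the sup norm over $z\in\mathbb C$), and $\widetilde S^i$ is twice continuously (real) differentiable in $(z,\mathbf t)$ on $\{|z|<1\}\times U$. A $\tau$-function is a differentiable function $\Theta$ of $\mathbf t\in U$ with $$\delta\Theta=\theta:=\frac1{2\pi i}\oint_{|z|=1}\bigl(\widetilde S^2\,\delta S^1_0-\widetilde S^1\,\delta S^2_0\bigr)\,dz .$$ For $|z|>1$ the vertex operators are $D^i(z)=\sum_{n\ge 1}z^{-n}\partial^i_n$. **Claim.** (0) If $U$ is convex, a $\tau$-function exists. For every $\tau$-function $\Theta$, $\Theta$ is $C^\infty$ (in the complex sense) on $U$, and at every $\mathbf t\in U$: (1) For $|z|>1$ the series $D^i(z)\Theta$ converge absolutely and $$\widetilde S^1(z)=-D^2(z)\Theta,\qquad \widetilde S^2(z)=D^1(z)\Theta .$$ (2) (Addition formulae.) For all $z,z',z''$ with $|z|,|z'|,|z''|>1$, $z'\ne z$, $z''\ne z$: $$\tfrac{1}{z'-z}D^1(z'')(D^1(z')-D^1(z))\Theta-\tfrac{1}{z''-z}D^1(z')(D^1(z'')-D^1(z))\Theta =D^1(z'')D^2(z)\Theta\cdot D^1(z')D^1(z)\Theta-D^1(z'')D^1(z)\Theta\cdot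 D^1(z')D^2(z)\Theta,$$ $$\tfrac{1}{z''-z}D^2(z')(D^2(z'')-D^2(z))\Theta-\tfrac{1}{z'-z}D^2(z'')(D^2(z')-D^2(z))\Theta =D^2(z')D^2(z)\Theta\cdot D^2(z'')D^1(z)\Theta-D^2(z')D^1(z)\Theta\cdot D^2(z'')D^2(z)\Theta,$$ $$\tfrac{1}{z'-z}D^2(z'')(D^1(z')-D^1(z))\Theta-\tfrac{1}{z''-z}D^1(z')(D^2(z'')-D^2(z))\Theta =D^1(z')D^1(z)\Theta\cdot D^2(z'')D^2(z)\Theta-D^1(z')D^2(z)\Theta\cdot D^2(z'')D^1(z)\Theta.$$ (3) (Heavenly hierarchy.) For $i,j\in\{1,2\}$, $a,c\ge1$, $b\ge2$, $$\partial^i_a\partial^j_{b+c-1}\Theta-\partial^i_{a+b-1}\partial^j_c\Theta=\sum_{p+q=b,\;p,q\ge1}\bigl(\partial^i_a\partial^1_p\Theta\cdot\partial^j_c\partial^2_q\Theta-\partial^i_a\partial^2_p\Theta\cdot\partial^j_c\partial^1_q\Theta\bigr).$$ (4) For $|z|>1$, $D^2(z)\Theta_x-D^1(z)\Theta_y-\{D^1(z)\Theta,D^2(z)\Theta\}=0$.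 (5) (Second heavenly equation.) $\Theta_{ty}-\Theta_{\tilde tx}-\Theta_{xy}^2+\Theta_{xx}\Theta_{yy}=0$. Moreover (3) is exactly the expansion of (2), and (5) the first nontrivial order of (4): for every complex-valued function $\Phi$ of the times that is $C^2$ (in the complex sense) at a point $\mathbf t$, (6) $\Phi$ satisfies all the addition formulae (2) at $\mathbf t$ if and only if it satisfies all the equations (3) at $\mathbf t$; (7) as $z\to\infty$, at the point $\mathbf t$, $$z^2\bigl(D^2(z)\Phi_x-D^1(z)\Phi_y-\{D^1(z)\Phi,D^2(z)\Phi\}\bigr)\longrightarrow-\bigl(\Phi_{ty}-\Phi_{\tilde tx}-\Phi_{xy}^2+\Phi_{xx}\Phi_{yy}\bigr).$$ -/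

import Mathlib

open scoped ZeroAtInfty ContDiff Topology

noncomputable section

namespace HeavenlyDbar

/-- Absolutely summable sequences of complex numbers. Entry `n : ℕ` (counted from `0`) of the
sequence number `i` is the time `t^i_{n+1}`. -/
abbrev TimeSeq : Type := lp (fun _ : ℕ => ℂ) 1

/-- The space of times `(𝐭¹, 𝐭²)`; the superscripts `1, 2` are the indices `0, 1 : Fin 2`. -/
abbrev Times : Type := Fin 2 → TimeSeq

/-- The boundary datum `S₀(z) = ∑_{n ≥ 1} t_n z^{n-1}`, used for `‖z‖ ≤ 1` only. -/
def bdry (u : TimeSeq) (z : ℂ) : ℂ := ∑' n : ℕ, u n * z ^ n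

/-- `∂f/∂z̄ = (∂f/∂(Re z) + i ∂f/∂(Im z)) / 2`. -/
def dbar (f : ℂ → ℂ) (z : ℂ) : ℂ :=
  (1 / 2) * (fderiv ℝ f z 1 + Complex.I * fderiv ℝ f z Complex.I)

/-- The unit vector of the time space in the direction of the time `t^i_{n+1}`. -/
def unitTime (i : Fin 2) (n : ℕ) : Times := Pi.single i (lp.single 1 n (1 : ℂ))

/-- The partial derivative `∂F/∂t^i_{n+1}`. -/
def pd (i : Fin 2) (n : ℕ) (F : Times → ℂ) (t : Times) : ℂ := lineDeriv ℂ F t (unitTime i n)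

/-- The vertex operator `D^i(z) = ∑_{n ≥ 1} z^{-n} ∂/∂t^i_n`. -/
def vertexD (i : Fin 2) (z : ℂ) (F : Times → ℂ) (t : Times) : ℂ :=
  ∑' n : ℕ, z⁻¹ ^ (n + 1) * pd i n F t

/-- The full function `S^i = S₀^i + S̃^i` (meaningful on the closed unit disc). -/
def full (St : Fin 2 → Times → C₀(ℂ, ℂ)) (i : Fin 2) (t : Times) (z : ℂ) : ℂ :=
  bdry (t i) z + St i t z

/-- A holomorphic family, over the set `U` of times, of solutions of the Hamiltonian
`∂̄`-problem `∂̄S¹ = ∂W/∂S²`, `∂̄S² = -∂W/∂S¹` in the unit disc. The corrections `S̃^i(·, t)`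
are continuous functions on `ℂ` which tend to `0` at infinity, which is what `C₀(ℂ, ℂ)`
(with the sup norm) means. -/
structure IsSolutionFamily (W : ℂ → ℂ × ℂ → ℂ) (U : Set Times)
    (St : Fin 2 → Times → C₀(ℂ, ℂ)) : Prop where
  /-- `W(z, ·, ·)` is holomorphic at the values taken by the solution. -/
  potential : ∀ t ∈ U, ∀ z ∈ Metric.ball (0 : ℂ) 1,
    AnalyticAt ℂ (W z) (full St 0 t z, full St 1 t z)
  /-- The solution depends holomorphically on the times. -/
  times : ∀ i, AnalyticOnNhd ℂ (St i) U
  /-- The solution is smooth in `(z, t)` for `z` in the open unit disc. -/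
  smooth : ∀ i, ContDiffOn ℝ 2 (fun p : ℂ × Times => St i p.2 p.1) (Metric.ball 0 1 ×ˢ U)
  /-- `S̃` is analytic outside the unit disc. -/
  outside : ∀ i, ∀ t ∈ U, DifferentiableOn ℂ (St i t) {z : ℂ | 1 < ‖z‖}
  eq_one : ∀ t ∈ U, ∀ z ∈ Metric.ball (0 : ℂ) 1,
    dbar (full St 0 t) z = fderiv ℂ (W z) (full St 0 t z, full St 1 t z) (0, 1)
  eq_two : ∀ t ∈ U, ∀ z ∈ Metric.ball (0 : ℂ) 1,
    dbar (full St 1 t) z = -fderiv ℂ (W z) (full St 0 t z, full St 1 t z) (1, 0)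

/-- The one-form `θ = (2πi)⁻¹ ∮ (S̃² δS₀¹ - S̃¹ δS₀²) dz` at `t`, evaluated on `δt = h`. -/
def tauForm (St : Fin 2 → Times → C₀(ℂ, ℂ)) (t h : Times) : ℂ :=
  (2 * Real.pi * Complex.I)⁻¹ *
    ∮ z in C(0, 1), (St 1 t z * bdry (h 0) z - St 0 t z * bdry (h 1) z)

/-- `Θ` is a `τ`-function on `U`: it is differentiable with `δΘ = θ`. -/
def IsTau (U : Set Times) (St : Fin 2 → Times → C₀(ℂ, ℂ)) (Θ : Times → ℂ) : Prop :=
  ∀ t ∈ U, DifferentiableAt ℂ Θ t ∧ ∀ h : Times, fderiv ℂ Θ t h = tauForm St t h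

/-- `{F, G} = F_x G_y - F_y G_x` with `x = t¹_1`, `y = t²_1`. -/
def bracket (F G : Times → ℂ) (t : Times) : ℂ :=
  pd 0 0 F t * pd 1 0 G t - pd 1 0 F t * pd 0 0 G t

/-- The three addition formulae at `t`, for the parameters `z, z', z''` (here `z, z₁, z₂`)
outside the closed unit disc with `z' ≠ z`, `z'' ≠ z`. -/
def AdditionFormulae (Θ : Times → ℂ) (t : Times) : Prop :=
  ∀ z z₁ z₂ : ℂ, 1 < ‖z‖ → 1 < ‖z₁‖ → 1 < ‖z₂‖ → z₁ ≠ z → z₂ ≠ z →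
    (1 / (z₁ - z) * vertexD 0 z₂ (fun s => vertexD 0 z₁ Θ s - vertexD 0 z Θ s) t
        - 1 / (z₂ - z) * vertexD 0 z₁ (fun s => vertexD 0 z₂ Θ s - vertexD 0 z Θ s) t
      = vertexD 0 z₂ (vertexD 1 z Θ) t * vertexD 0 z₁ (vertexD 0 z Θ) t
        - vertexD 0 z₂ (vertexD 0 z Θ) t * vertexD 0 z₁ (vertexD 1 z Θ) t) ∧
    (1 / (z₂ - z) * vertexD 1 z₁ (fun s => vertexD 1 z₂ Θ s - vertexD 1 z Θ s) t
        - 1 / (z₁ - z) * vertexD 1 z₂ (fun s => vertexD 1 z₁ Θ s - vertexD 1 z Θ s) t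
      = vertexD 1 z₁ (vertexD 1 z Θ) t * vertexD 1 z₂ (vertexD 0 z Θ) t
        - vertexD 1 z₁ (vertexD 0 z Θ) t * vertexD 1 z₂ (vertexD 1 z Θ) t) ∧
    (1 / (z₁ - z) * vertexD 1 z₂ (fun s => vertexD 0 z₁ Θ s - vertexD 0 z Θ s) t
        - 1 / (z₂ - z) * vertexD 0 z₁ (fun s => vertexD 1 z₂ Θ s - vertexD 1 z Θ s) t
      = vertexD 0 z₁ (vertexD 0 z Θ) t * vertexD 1 z₂ (vertexD 1 z Θ) t
        - vertexD 0 z₁ (vertexD 1 z Θ) t * vertexD 1 z₂ (vertexD 0 z Θ) t)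

/-- The heavenly equation hierarchy at `t`: with times numbered from `1`,
`∂^i_a ∂^j_{b+c-1} Θ - ∂^i_{a+b-1} ∂^j_c Θ
  = ∑_{p+q=b} (∂^i_a ∂¹_p Θ · ∂^j_c ∂²_q Θ - ∂^i_a ∂²_p Θ · ∂^j_c ∂¹_q Θ)`
for `i, j ∈ {1, 2}`, `a, c ≥ 1`, `b ≥ 2`. In the code `a, c, p, q` are numbered from `0`
and `b` from `2`. -/
def HeavenlyHierarchy (Θ : Times → ℂ) (t : Times) : Prop :=
  ∀ (i j : Fin 2) (a b c : ℕ),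
    pd i a (pd j (b + c + 1) Θ) t - pd i (a + b + 1) (pd j c Θ) t
      = ∑ pq ∈ Finset.HasAntidiagonal.antidiagonal b,
          (pd i a (pd 0 pq.1 Θ) t * pd j c (pd 1 pq.2 Θ) t
            - pd i a (pd 1 pq.1 Θ) t * pd j c (pd 0 pq.2 Θ) t)

/-- `D²(z)Θ_x - D¹(z)Θ_y - {D¹(z)Θ, D²(z)Θ}`. -/
def generating (Θ : Times → ℂ) (z : ℂ) (t : Times) : ℂ :=
  vertexD 1 z (pd 0 0 Θ) t - vertexD 0 z (pd 1 0 Θ) t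
    - bracket (vertexD 0 z Θ) (vertexD 1 z Θ) t

/-- `Θ_{ty} - Θ_{t̃x} - Θ_{xy}² + Θ_{xx} Θ_{yy}`, where `x = t¹_1`, `y = t²_1`, `t = t¹_2`,
`t̃ = t²_2`. -/
def heavenly (Θ : Times → ℂ) (t : Times) : ℂ :=
  pd 1 0 (pd 0 1 Θ) t - pd 0 0 (pd 1 1 Θ) t - (pd 1 0 (pd 0 0 Θ) t) ^ 2
    + pd 0 0 (pd 0 0 Θ) t * pd 1 0 (pd 1 0 Θ) t

end HeavenlyDbar

end

noncomputable section

namespace HeavenlyDbar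

open Filter

/-! ### Power series -/

/-! The theorem rests on one bilinear relation. Differentiating the `∂̄`-problem in the times shows
that a variation `v_h` of `(S¹, S²)` solves a linear system governed by the Hessian of `W`. The
Hessian is symmetric, so the symplectic product of two variations satisfies `∂̄ = 0` and is analytic
in the disc (`differentiableAt_symplectic`). Multiply it by `z^m` and integrate over the unit
circle: the result is `0`. Split each variation into boundary datum plus correction. The purely
boundary part integrates to `0` by Cauchy, the cross terms are values of the derivative of `θ`, and
the remaining terms are moments of products of functions analytic outside the disc
(`bilinear_relation`).

For `m = 0` these moments vanish, since the products are `O(z⁻²)`; hence `θ` is closed and has a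
primitive on a convex set. For `m ≥ 1` they are convolutions of moments of the factors
(`moment_mul`), and those moments are second derivatives of `Θ` up to sign. Taking unit directions
gives the heavenly hierarchy. The Laurent expansion `hasSum_moment` recovers the corrections from
`Θ`.

The rest is algebra of a symmetric bilinear form, the second derivative. With `w = z⁻¹`, the
addition formulae are the generating functions of the hierarchy in its three indices. The equation
for `generating` is the generating function in `b` alone, and the heavenly equation is its first
coefficient. -/

lemma eq_zero_of_hasSum_pow {α : ℕ → ℂ}
    (h : ∀ᶠ w in 𝓝[≠] (0 : ℂ), HasSum (fun n => w ^ n * α n) 0) (n : ℕ) : α n = 0 := by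
  set p := FormalMultilinearSeries.ofScalars ℂ α
  have hp : 0 < p.radius := by
    obtain ⟨w, hw, hw0⟩ := (h.and self_mem_nhdsWithin).exists
    refine lt_of_lt_of_le (b := (‖w‖₊ : ENNReal)) (by simpa using hw0) ?_
    refine FormalMultilinearSeries.le_radius_of_summable_norm _ ?_
    refine hw.summable.norm.congr fun n => ?_
    simp [p, mul_comm]
  have hs := (p.hasFPowerSeriesOnBall hp).hasFPowerSeriesAt
  have h0 : ∀ᶠ w in 𝓝 (0 : ℂ), p.sum w = 0 := by
    have h1 : ∀ᶠ w in 𝓝[≠] (0 : ℂ), p.sum w = 0 := h.mono fun w hw => by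
      rw [← hw.tsum_eq]
      simp [p, FormalMultilinearSeries.sum, mul_comm]
    -- Zeros of a nonzero analytic function are isolated, so vanishing near `0` but off `0` already
    -- forces vanishing at `0`.
    rcases hs.analyticAt.eventually_eq_zero_or_eventually_ne_zero with h2 | h2
    · exact h2
    · obtain ⟨w, hw⟩ := (h1.and h2).exists
      exact absurd hw.1 hw.2
  exact congrFun (FormalMultilinearSeries.ofScalars_series_eq_zero (E := ℂ) |>.1
    (hs.eq_zero_of_eventually h0)) n

lemma hasSum_pow_mul_antidiagonal {α β : ℕ → ℂ} {A B w : ℂ}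
    (hα : HasSum (fun n => w ^ n * α n) A) (hβ : HasSum (fun n => w ^ n * β n) B) :
    HasSum (fun n => w ^ n * ∑ pq ∈ Finset.HasAntidiagonal.antidiagonal n, α pq.1 * β pq.2) (A * B) := by
  have h1 := (summable_norm_sum_mul_antidiagonal_of_summable_norm
    hα.summable.norm hβ.summable.norm).of_norm.hasSum
  rw [← tsum_mul_tsum_eq_tsum_sum_antidiagonal_of_summable_norm hα.summable.norm
    hβ.summable.norm, hα.tsum_eq, hβ.tsum_eq] at h1
  refine h1.congr_fun fun n => ?_
  rw [Finset.mul_sum]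
  refine Finset.sum_congr rfl fun pq hpq => ?_
  rw [← Finset.HasAntidiagonal.mem_antidiagonal.1 hpq, pow_add]
  ring

/-! ### Vectors in the space of times -/

lemma norm_unitTime (i : Fin 2) (n : ℕ) : ‖unitTime i n‖ = 1 := by
  rw [unitTime, Pi.norm_single, lp.norm_single (by norm_num), norm_one]

/-- The vector `∑ w^q ∂/∂t^i_{a+q+1}`. -/
def geomVec (i : Fin 2) (a : ℕ) (w : ℂ) : Times := ∑' q : ℕ, w ^ q • unitTime i (a + q)

variable {w w₁ w₂ : ℂ}

lemma norm_pow_smul_unitTime (i : Fin 2) (n q : ℕ) : ‖w ^ q • unitTime i n‖ = ‖w‖ ^ q := by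
  simp [norm_smul, norm_unitTime]

lemma hasSum_geomVec (i : Fin 2) (a : ℕ) (hw : ‖w‖ < 1) :
    HasSum (fun q : ℕ => w ^ q • unitTime i (a + q)) (geomVec i a w) := by
  refine (Summable.of_norm ?_).hasSum
  simpa only [norm_pow_smul_unitTime] using summable_geometric_of_lt_one (norm_nonneg _) hw

lemma norm_geomVec_le (i : Fin 2) (a : ℕ) (hw : ‖w‖ < 1) : ‖geomVec i a w‖ ≤ (1 - ‖w‖)⁻¹ :=
  tsum_of_norm_bounded (hasSum_geometric_of_lt_one (norm_nonneg _) hw)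
    fun q => (norm_pow_smul_unitTime i _ q).le

lemma geomVec_eq (i : Fin 2) (a : ℕ) (hw : ‖w‖ < 1) :
    geomVec i a w = unitTime i a + w • geomVec i (a + 1) w := by
  have h := (hasSum_geomVec i a hw).summable.tsum_eq_zero_add
  rw [← geomVec] at h
  rw [h, geomVec, ← (hasSum_geomVec i (a + 1) hw).summable.tsum_const_smul]
  simp [smul_smul, pow_succ', add_assoc, add_comm 1]

lemma tendsto_geomVec (i : Fin 2) (a : ℕ) :
    Tendsto (geomVec i a) (𝓝 0) (𝓝 (unitTime i a)) := by
  -- On this disc `(1 - ‖w‖)⁻¹ ≤ 2`, which bounds the tail uniformly.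
  have h1 : ∀ᶠ w : ℂ in 𝓝 0, ‖w‖ < 1 / 2 :=
    continuous_norm.continuousAt.eventually_lt continuousAt_const (by simp)
  have h2 : Tendsto (fun w : ℂ => w • geomVec i (a + 1) w) (𝓝 0) (𝓝 0) := by
    refine squeeze_zero_norm' (a := fun w : ℂ => ‖w‖ * 2) ?_ ?_
    · filter_upwards [h1] with w hw
      rw [norm_smul]
      gcongr
      refine (norm_geomVec_le i _ (by linarith)).trans ?_
      rw [inv_le_comm₀ (by linarith) (by norm_num)]
      linarith
    · simpa using (continuous_norm.tendsto (0 : ℂ)).mul_const 2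
  refine (by simpa using h2.const_add (unitTime i a) :
    Tendsto (fun w : ℂ => unitTime i a + w • geomVec i (a + 1) w) (𝓝 0) _).congr' ?_
  filter_upwards [h1] with w hw
  exact (geomVec_eq i a (by linarith)).symm

lemma hasSum_map_geomVec (φ : Times →L[ℂ] ℂ) (i : Fin 2) (a : ℕ) (hw : ‖w‖ < 1) :
    HasSum (fun q : ℕ => w ^ q * φ (unitTime i (a + q))) (φ (geomVec i a w)) := by
  simpa using φ.hasSum (hasSum_geomVec i a hw)

/-- Source of the divided differences in the addition formulae. The series `∑ w₁^a • geomVec i a w`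
is computed twice, by splitting off `a = 0` and by applying `geomVec_eq` to each term; comparing the
results multiplies the required sum by `w₁ - w`. -/
lemma hasSum_smul_geomVec (i : Fin 2) (hw : ‖w‖ < 1) (hw₁ : ‖w₁‖ < 1) (hne : w₁ ≠ w) :
    HasSum (fun a : ℕ => w₁ ^ a • geomVec i (a + 1) w)
      ((w₁ - w)⁻¹ • (geomVec i 0 w₁ - geomVec i 0 w)) := by
  have hs (m : ℕ) : Summable fun a : ℕ => w₁ ^ a • geomVec i (a + m) w := by
    refine Summable.of_norm_bounded (g := fun a => ‖w₁‖ ^ a * (1 - ‖w‖)⁻¹)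
      ((summable_geometric_of_lt_one (norm_nonneg _) hw₁).mul_right _) fun a => ?_
    rw [norm_smul, norm_pow]
    gcongr
    exact norm_geomVec_le i _ hw
  have h1 : ∑' a : ℕ, w₁ ^ a • geomVec i a w =
      geomVec i 0 w + w₁ • ∑' a : ℕ, w₁ ^ a • geomVec i (a + 1) w := by
    rw [(show Summable fun a : ℕ => w₁ ^ a • geomVec i a w from hs 0).tsum_eq_zero_add, ← (hs 1).tsum_const_smul]
    simp [smul_smul, pow_succ']
  have h2 : ∑' a : ℕ, w₁ ^ a • geomVec i a w =
      geomVec i 0 w₁ + w • ∑' a : ℕ, w₁ ^ a • geomVec i (a + 1) w := by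
    rw [geomVec, ← (hs 1).tsum_const_smul]
    have h3 := (hasSum_geomVec i 0 hw₁).summable
    simp only [zero_add] at h3 ⊢
    rw [← h3.tsum_add ((hs 1).const_smul w)]
    refine tsum_congr fun a => ?_
    rw [geomVec_eq i a hw, smul_add, smul_comm]
  have h4 : (w₁ - w) • ∑' a : ℕ, w₁ ^ a • geomVec i (a + 1) w =
      geomVec i 0 w₁ - geomVec i 0 w := by
    rw [h2] at h1
    rw [sub_smul, sub_eq_sub_iff_add_eq_add, add_comm, ← h1, add_comm]
  rw [← h4, smul_smul, inv_mul_cancel₀ (sub_ne_zero.2 hne), one_smul]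
  exact (hs 1).hasSum

/-! ### Partial derivatives and vertex operators -/

variable {F G Φ : Times → ℂ} {t : Times} {z z₁ z₂ : ℂ}

/-- The direction of the vertex operator `D^i(z)`. -/
def vertexVec (i : Fin 2) (z : ℂ) : Times := z⁻¹ • geomVec i 0 z⁻¹

lemma norm_inv_lt_one (hz : 1 < ‖z‖) : ‖z⁻¹‖ < 1 := by
  rw [norm_inv]; exact inv_lt_one_of_one_lt₀ hz

lemma pd_eq_fderiv (hF : DifferentiableAt ℂ F t) (i : Fin 2) (n : ℕ) :
    pd i n F t = fderiv ℂ F t (unitTime i n) := hF.lineDeriv_eq_fderiv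

lemma hasSum_vertexD (hF : DifferentiableAt ℂ F t) (hz : 1 < ‖z‖) (i : Fin 2) :
    HasSum (fun n : ℕ => z⁻¹ ^ (n + 1) * pd i n F t) (fderiv ℂ F t (vertexVec i z)) := by
  rw [vertexVec, map_smul, smul_eq_mul]
  refine ((hasSum_map_geomVec (fderiv ℂ F t) i 0 (norm_inv_lt_one hz)).mul_left z⁻¹).congr_fun ?_
  intro n
  simp [pd_eq_fderiv hF, pow_succ', mul_assoc]

lemma vertexD_eq_fderiv (hF : DifferentiableAt ℂ F t) (hz : 1 < ‖z‖) (i : Fin 2) :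
    vertexD i z F t = fderiv ℂ F t (vertexVec i z) := (hasSum_vertexD hF hz i).tsum_eq

lemma pd_congr (h : F =ᶠ[𝓝 t] G) (i : Fin 2) (n : ℕ) : pd i n F t = pd i n G t :=
  h.lineDeriv_eq

lemma vertexD_congr (h : F =ᶠ[𝓝 t] G) (i : Fin 2) (z : ℂ) : vertexD i z F t = vertexD i z G t := by
  simp only [vertexD, pd_congr h]

section SecondDerivative

variable (hΦ : ContDiffAt ℂ 2 Φ t)
include hΦ

lemma differentiableAt_fderiv_of_contDiffAt : DifferentiableAt ℂ (fderiv ℂ Φ) t :=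
  (hΦ.fderiv_right (m := 1) (by norm_num)).differentiableAt (by norm_num)

lemma eventually_differentiableAt : ∀ᶠ s in 𝓝 t, DifferentiableAt ℂ Φ s := by
  filter_upwards [hΦ.eventually (by simp)] with s hs
  exact hs.differentiableAt (by norm_num)

/-- Equality near `t`, not only at `t`, is what allows the inner operator of an iterated derivative
to be replaced. -/
lemma pd_eventuallyEq (i : Fin 2) (n : ℕ) :
    pd i n Φ =ᶠ[𝓝 t] fun s => fderiv ℂ Φ s (unitTime i n) := by
  filter_upwards [eventually_differentiableAt hΦ] with s hs using pd_eq_fderiv hs i n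

lemma vertexD_eventuallyEq (i : Fin 2) (hz : 1 < ‖z‖) :
    vertexD i z Φ =ᶠ[𝓝 t] fun s => fderiv ℂ Φ s (vertexVec i z) := by
  filter_upwards [eventually_differentiableAt hΦ] with s hs using vertexD_eq_fderiv hs hz i

lemma hasFDerivAt_fderiv_apply (u : Times) :
    HasFDerivAt (fun s => fderiv ℂ Φ s u) ((fderiv ℂ (fderiv ℂ Φ) t).flip u) t :=
  ((ContinuousLinearMap.apply ℂ ℂ u).hasFDerivAt.comp t
    (differentiableAt_fderiv_of_contDiffAt hΦ).hasFDerivAt)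

lemma second_pd (i j : Fin 2) (a b : ℕ) :
    pd i a (pd j b Φ) t = fderiv ℂ (fderiv ℂ Φ) t (unitTime i a) (unitTime j b) := by
  rw [pd_congr (pd_eventuallyEq hΦ j b), 
    pd_eq_fderiv (hasFDerivAt_fderiv_apply hΦ _).differentiableAt,
    (hasFDerivAt_fderiv_apply hΦ _).fderiv, ContinuousLinearMap.flip_apply]

lemma pd_vertexD (i j : Fin 2) (a : ℕ) (hz : 1 < ‖z‖) :
    pd i a (vertexD j z Φ) t = fderiv ℂ (fderiv ℂ Φ) t (unitTime i a) (vertexVec j z) := by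
  rw [pd_congr (vertexD_eventuallyEq hΦ j hz), 
    pd_eq_fderiv (hasFDerivAt_fderiv_apply hΦ _).differentiableAt,
    (hasFDerivAt_fderiv_apply hΦ _).fderiv, ContinuousLinearMap.flip_apply]

lemma vertexD_pd (i j : Fin 2) (b : ℕ) (hz : 1 < ‖z‖) :
    vertexD i z (pd j b Φ) t = fderiv ℂ (fderiv ℂ Φ) t (vertexVec i z) (unitTime j b) := by
  rw [vertexD_congr (pd_eventuallyEq hΦ j b), 
    vertexD_eq_fderiv (hasFDerivAt_fderiv_apply hΦ _).differentiableAt hz,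
    (hasFDerivAt_fderiv_apply hΦ _).fderiv, ContinuousLinearMap.flip_apply]

lemma vertexD_vertexD (i j : Fin 2) (hz : 1 < ‖z‖) (hz₁ : 1 < ‖z₁‖) :
    vertexD i z (vertexD j z₁ Φ) t
      = fderiv ℂ (fderiv ℂ Φ) t (vertexVec i z) (vertexVec j z₁) := by
  rw [vertexD_congr (vertexD_eventuallyEq hΦ j hz₁), 
    vertexD_eq_fderiv (hasFDerivAt_fderiv_apply hΦ _).differentiableAt hz,
    (hasFDerivAt_fderiv_apply hΦ _).fderiv, ContinuousLinearMap.flip_apply]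

lemma vertexD_vertexD_sub (i j : Fin 2) (hz : 1 < ‖z‖) (hz₁ : 1 < ‖z₁‖) (hz₂ : 1 < ‖z₂‖) :
    vertexD i z (fun s => vertexD j z₁ Φ s - vertexD j z₂ Φ s) t
      = fderiv ℂ (fderiv ℂ Φ) t (vertexVec i z) (vertexVec j z₁ - vertexVec j z₂) := by
  have h : (fun s => vertexD j z₁ Φ s - vertexD j z₂ Φ s) =ᶠ[𝓝 t]
      fun s => fderiv ℂ Φ s (vertexVec j z₁ - vertexVec j z₂) := by
    filter_upwards [vertexD_eventuallyEq hΦ j hz₁, vertexD_eventuallyEq hΦ j hz₂] with s h1 h2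
    rw [h1, h2, map_sub]
  rw [vertexD_congr h, 
    vertexD_eq_fderiv (hasFDerivAt_fderiv_apply hΦ _).differentiableAt hz,
    (hasFDerivAt_fderiv_apply hΦ _).fderiv, ContinuousLinearMap.flip_apply]

lemma second_fderiv_symm (h k : Times) :
    fderiv ℂ (fderiv ℂ Φ) t h k = fderiv ℂ (fderiv ℂ Φ) t k h :=
  hΦ.isSymmSndFDerivAt (by simp) h k

end SecondDerivative

/-! ### Addition formulae and the hierarchy for a symmetric bilinear form -/

section BilinearForm

variable (H : Times →L[ℂ] Times →L[ℂ] ℂ) (i j : Fin 2) {w w₁ w₂ : ℂ}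

/-- The difference of the two sides of an equation of the heavenly hierarchy, for a bilinear form
in the place of the second derivative. -/
def hierarchyDefect (a b c : ℕ) : ℂ :=
  H (unitTime i a) (unitTime j (b + c + 1)) - H (unitTime i (a + b + 1)) (unitTime j c)
    - ∑ pq ∈ Finset.HasAntidiagonal.antidiagonal b,
        (H (unitTime i a) (unitTime 0 pq.1) * H (unitTime j c) (unitTime 1 pq.2)
          - H (unitTime i a) (unitTime 1 pq.1) * H (unitTime j c) (unitTime 0 pq.2))

/-- The generating function of `hierarchyDefect` in the second index. -/
def hierarchyGen (w : ℂ) (a c : ℕ) : ℂ :=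
  H (unitTime i a) (geomVec j (c + 1) w) - H (geomVec i (a + 1) w) (unitTime j c)
    - (H (unitTime i a) (geomVec 0 0 w) * H (unitTime j c) (geomVec 1 0 w)
        - H (unitTime i a) (geomVec 1 0 w) * H (unitTime j c) (geomVec 0 0 w))

/-- The generating function of `hierarchyDefect` in the last two indices. -/
def hierarchyGenRight (w w₂ : ℂ) (a : ℕ) : ℂ :=
  H (unitTime i a) ((w₂ - w)⁻¹ • (geomVec j 0 w₂ - geomVec j 0 w))
    - H (geomVec i (a + 1) w) (geomVec j 0 w₂)
    - (H (unitTime i a) (geomVec 0 0 w) * H (geomVec j 0 w₂) (geomVec 1 0 w)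
        - H (unitTime i a) (geomVec 1 0 w) * H (geomVec j 0 w₂) (geomVec 0 0 w))

/-- The generating function of `hierarchyDefect` in all indices. -/
def hierarchyGenFull (w w₁ w₂ : ℂ) : ℂ :=
  H (geomVec i 0 w₁) ((w₂ - w)⁻¹ • (geomVec j 0 w₂ - geomVec j 0 w))
    - H ((w₁ - w)⁻¹ • (geomVec i 0 w₁ - geomVec i 0 w)) (geomVec j 0 w₂)
    - (H (geomVec i 0 w₁) (geomVec 0 0 w) * H (geomVec j 0 w₂) (geomVec 1 0 w)
        - H (geomVec i 0 w₁) (geomVec 1 0 w) * H (geomVec j 0 w₂) (geomVec 0 0 w))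

/-- The sum over the antidiagonal is a Cauchy product in `b`, so the quadratic part factors. Summing
one index at a time, here `b`, later `c` and `a`, avoids any summability question for the triple
family. -/
lemma hasSum_hierarchyGen (hw : ‖w‖ < 1) (a c : ℕ) :
    HasSum (fun b => w ^ b * hierarchyDefect H i j a b c) (hierarchyGen H i j w a c) := by
  have h1 := hasSum_map_geomVec (H (unitTime i a)) j (c + 1) hw
  have h2 := hasSum_map_geomVec (H.flip (unitTime j c)) i (a + 1) hw
  have h3 (k l : Fin 2) := hasSum_pow_mul_antidiagonal
    (hasSum_map_geomVec (H (unitTime i a)) k 0 hw) (hasSum_map_geomVec (H (unitTime j c)) l 0 hw)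
  refine ((h1.sub h2).sub ((h3 0 1).sub (h3 1 0))).congr_fun fun b => ?_
  simp only [hierarchyDefect, ContinuousLinearMap.flip_apply, zero_add, Finset.sum_sub_distrib,
    show c + 1 + b = b + c + 1 by ring, show a + 1 + b = a + b + 1 by ring]
  ring

lemma hasSum_hierarchyGenRight (hw : ‖w‖ < 1) (hw₂ : ‖w₂‖ < 1) (hne : w₂ ≠ w) (a : ℕ) :
    HasSum (fun c => w₂ ^ c * hierarchyGen H i j w a c) (hierarchyGenRight H i j w w₂ a) := by
  have h1 := (H (unitTime i a)).hasSum (hasSum_smul_geomVec j hw hw₂ hne)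
  have h2 (u : Times) := hasSum_map_geomVec (H.flip u) j 0 hw₂
  have h3 := hasSum_map_geomVec (H (geomVec i (a + 1) w)) j 0 hw₂
  refine ((h1.sub h3).sub (((h2 (geomVec 1 0 w)).mul_left (H (unitTime i a) (geomVec 0 0 w))).sub
    ((h2 (geomVec 0 0 w)).mul_left (H (unitTime i a) (geomVec 1 0 w))))).congr_fun fun c => ?_
  simp only [hierarchyGen, ContinuousLinearMap.flip_apply, zero_add, map_smul, smul_eq_mul]
  ring

lemma hasSum_hierarchyGenFull (hw : ‖w‖ < 1) (hw₁ : ‖w₁‖ < 1) (hne : w₁ ≠ w) :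
    HasSum (fun a => w₁ ^ a * hierarchyGenRight H i j w w₂ a)
      (hierarchyGenFull H i j w w₁ w₂) := by
  have h1 := (H.flip (geomVec j 0 w₂)).hasSum (hasSum_smul_geomVec i hw hw₁ hne)
  have h2 (u : Times) := hasSum_map_geomVec (H.flip u) i 0 hw₁
  refine (((h2 _).sub h1).sub
    (((h2 (geomVec 0 0 w)).mul_right (H (geomVec j 0 w₂) (geomVec 1 0 w))).sub
    ((h2 (geomVec 1 0 w)).mul_right (H (geomVec j 0 w₂) (geomVec 0 0 w))))).congr_fun fun c => ?_
  simp only [hierarchyGenRight, ContinuousLinearMap.flip_apply, zero_add]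
  rw [map_smul H, smul_apply, smul_eq_mul]
  ring

lemma eventually_nhdsNE_of_unit_disc {p : ℂ → Prop} (hw : w ≠ 0)
    (h : ∀ w₁, w₁ ≠ 0 → ‖w₁‖ < 1 → w₁ ≠ w → p w₁) : ∀ᶠ w₁ in 𝓝[≠] (0 : ℂ), p w₁ := by
  have h1 : ∀ᶠ w₁ : ℂ in 𝓝[≠] 0, ‖w₁‖ < 1 :=
    (continuous_norm.continuousAt.eventually_lt continuousAt_const (by simp)).filter_mono
      nhdsWithin_le_nhds
  filter_upwards [h1, self_mem_nhdsWithin,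
    (eventually_ne_nhds hw.symm).filter_mono nhdsWithin_le_nhds] with w₁ h2 h3 h4
  exact h w₁ h3 h2 h4

/-- Coefficients are extracted one variable at a time. For fixed `w ≠ 0` the excluded values `w₁ =
w` and `w₂ = w` stay away from `0`, so uniqueness of power series near `0` applies. -/
lemma hierarchyGenFull_eq_zero_iff :
    (∀ w w₁ w₂ : ℂ, w ≠ 0 → w₁ ≠ 0 → w₂ ≠ 0 → ‖w‖ < 1 → ‖w₁‖ < 1 → ‖w₂‖ < 1 → w₁ ≠ w → w₂ ≠ w →
      hierarchyGenFull H i j w w₁ w₂ = 0) ↔ ∀ a b c, hierarchyDefect H i j a b c = 0 := by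
  constructor
  · intro h a b c
    refine eq_zero_of_hasSum_pow (α := fun b => hierarchyDefect H i j a b c)
      (eventually_nhdsNE_of_unit_disc (w := 2) two_ne_zero fun w hw0 hw _ => ?_) b
    rw [← show hierarchyGen H i j w a c = 0 from ?_]
    · exact hasSum_hierarchyGen H i j hw a c
    refine eq_zero_of_hasSum_pow (α := fun c => hierarchyGen H i j w a c)
      (eventually_nhdsNE_of_unit_disc hw0 fun w₂ hw₂0 hw₂ hne₂ => ?_) c
    rw [← show hierarchyGenRight H i j w w₂ a = 0 from ?_]
    · exact hasSum_hierarchyGenRight H i j hw hw₂ hne₂ a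
    refine eq_zero_of_hasSum_pow (α := fun a => hierarchyGenRight H i j w w₂ a)
      (eventually_nhdsNE_of_unit_disc hw0 fun w₁ hw₁0 hw₁ hne₁ => ?_) a
    rw [← h w w₁ w₂ hw0 hw₁0 hw₂0 hw hw₁ hw₂ hne₁ hne₂]
    exact hasSum_hierarchyGenFull H i j hw hw₁ hne₁
  · intro h w w₁ w₂ _ _ _ hw hw₁ hw₂ hne₁ hne₂
    have h1 (a c : ℕ) : hierarchyGen H i j w a c = 0 :=
      (hasSum_hierarchyGen H i j hw a c).unique (by simp [h, hasSum_zero])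
    have h2 (a : ℕ) : hierarchyGenRight H i j w w₂ a = 0 :=
      (hasSum_hierarchyGenRight H i j hw hw₂ hne₂ a).unique (by simp [h1, hasSum_zero])
    exact (hasSum_hierarchyGenFull H i j hw hw₁ hne₁).unique (by simp [h2, hasSum_zero])

/-- The difference of the two sides of an addition formula, for a bilinear form in the place of
the second derivative. -/
def additionDefect (z z₁ z₂ : ℂ) : ℂ :=
  1 / (z₁ - z) * H (vertexVec j z₂) (vertexVec i z₁ - vertexVec i z)
    - 1 / (z₂ - z) * H (vertexVec i z₁) (vertexVec j z₂ - vertexVec j z)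
    - (H (vertexVec j z₂) (vertexVec 1 z) * H (vertexVec i z₁) (vertexVec 0 z)
      - H (vertexVec j z₂) (vertexVec 0 z) * H (vertexVec i z₁) (vertexVec 1 z))

/-- The prefactor collects the factor `z⁻¹` in each `vertexVec`. Symmetry merges the terms pairing
`z₁` with `z₂`; their coefficients agree because `z₁ / (z₁ - z) = 1 + z / (z₁ - z)`, likewise for
`z₂`, and the two ones cancel. -/
lemma additionDefect_eq (hH : ∀ h k, H h k = H k h) {z z₁ z₂ : ℂ} (hz : z ≠ 0) (hz₁ : z₁ ≠ 0)
    (hz₂ : z₂ ≠ 0) (hne₁ : z₁ ≠ z) (hne₂ : z₂ ≠ z) :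
    additionDefect H i j z z₁ z₂
      = z⁻¹ ^ 2 * z₁⁻¹ * z₂⁻¹ * hierarchyGenFull H i j z⁻¹ z₁⁻¹ z₂⁻¹ := by
  have e₁ : (z₁⁻¹ - z⁻¹)⁻¹ = -(z * z₁ / (z₁ - z)) := by
    rw [inv_sub_inv hz₁ hz, inv_div, ← neg_sub z₁ z, div_neg, mul_comm]
  have e₂ : (z₂⁻¹ - z⁻¹)⁻¹ = -(z * z₂ / (z₂ - z)) := by
    rw [inv_sub_inv hz₂ hz, inv_div, ← neg_sub z₂ z, div_neg, mul_comm]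
  have d₁ := sub_ne_zero.2 hne₁
  have d₂ := sub_ne_zero.2 hne₂
  simp only [additionDefect, hierarchyGenFull, vertexVec, map_sub, map_smul, smul_eq_mul, e₁, e₂,
    sub_apply, smul_apply]
  rw [hH (geomVec j 0 z₂⁻¹) (geomVec i 0 z₁⁻¹), hH (geomVec j 0 z₂⁻¹) (geomVec i 0 z⁻¹)]
  field_simp
  ring

/-- This is why three addition formulae suffice for the four pairs `(i, j)`: the pair `(1, 0)`
follows from `(0, 1)`. -/
lemma additionDefect_swap (z z₁ z₂ : ℂ) :
    additionDefect H j i z z₂ z₁ = -additionDefect H i j z z₁ z₂ := by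
  simp only [additionDefect]; ring

lemma additionDefect_eq_zero_iff (hH : ∀ h k, H h k = H k h) :
    (∀ z z₁ z₂ : ℂ, 1 < ‖z‖ → 1 < ‖z₁‖ → 1 < ‖z₂‖ → z₁ ≠ z → z₂ ≠ z →
      additionDefect H i j z z₁ z₂ = 0) ↔ ∀ a b c, hierarchyDefect H i j a b c = 0 := by
  have hn : ∀ {z : ℂ}, 1 < ‖z‖ → z ≠ 0 := fun hz => norm_pos_iff.1 (one_pos.trans hz)
  rw [← hierarchyGenFull_eq_zero_iff]
  constructor
  · intro h w w₁ w₂ hw0 hw₁0 hw₂0 hw hw₁ hw₂ hne₁ hne₂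
    have hinv : ∀ {w : ℂ}, w ≠ 0 → ‖w‖ < 1 → 1 < ‖w⁻¹‖ := fun h0 h1 => by
      rw [norm_inv]; exact (one_lt_inv₀ (norm_pos_iff.2 h0)).2 h1
    have h1 := h w⁻¹ w₁⁻¹ w₂⁻¹ (hinv hw0 hw) (hinv hw₁0 hw₁) (hinv hw₂0 hw₂)
      (by simpa using hne₁) (by simpa using hne₂)
    rw [additionDefect_eq H i j hH (by simpa) (by simpa) (by simpa) (by simpa using hne₁)
      (by simpa using hne₂)] at h1
    simpa [hw0, hw₁0, hw₂0] using h1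
  · intro h z z₁ z₂ hz hz₁ hz₂ hne₁ hne₂
    rw [additionDefect_eq H i j hH (hn hz) (hn hz₁) (hn hz₂) hne₁ hne₂,
      h _ _ _ (inv_ne_zero (hn hz)) (inv_ne_zero (hn hz₁)) (inv_ne_zero (hn hz₂))
        (norm_inv_lt_one hz) (norm_inv_lt_one hz₁) (norm_inv_lt_one hz₂)
        (by simpa using hne₁) (by simpa using hne₂), mul_zero]

end BilinearForm

variable {Φ : Times → ℂ} {t : Times}

section SecondDerivative

variable (hΦ : ContDiffAt ℂ 2 Φ t)
include hΦ

lemma additionFormulae_iff : AdditionFormulae Φ t ↔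
    ∀ i j, ∀ z z₁ z₂ : ℂ, 1 < ‖z‖ → 1 < ‖z₁‖ → 1 < ‖z₂‖ → z₁ ≠ z → z₂ ≠ z →
      additionDefect (fderiv ℂ (fderiv ℂ Φ) t) i j z z₁ z₂ = 0 := by
  constructor
  · intro h
    have h01 : ∀ z z₁ z₂ : ℂ, 1 < ‖z‖ → 1 < ‖z₁‖ → 1 < ‖z₂‖ → z₁ ≠ z → z₂ ≠ z →
        additionDefect (fderiv ℂ (fderiv ℂ Φ) t) 0 1 z z₁ z₂ = 0 := by
      intro z z₁ z₂ hz hz₁ hz₂ hne₁ hne₂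
      have h3 := (h z z₁ z₂ hz hz₁ hz₂ hne₁ hne₂).2.2
      simp only [vertexD_vertexD_sub hΦ _ _, vertexD_vertexD hΦ, hz, hz₁, hz₂] at h3
      rw [additionDefect]
      linear_combination h3
    refine Fin.forall_fin_two.2 ⟨Fin.forall_fin_two.2 ⟨?_, h01⟩, Fin.forall_fin_two.2 ⟨?_, ?_⟩⟩ <;>
      intro z z₁ z₂ hz hz₁ hz₂ hne₁ hne₂ <;>
      obtain ⟨h1, h2, -⟩ := h z z₁ z₂ hz hz₁ hz₂ hne₁ hne₂ <;>
      simp only [vertexD_vertexD_sub hΦ _ _, vertexD_vertexD hΦ, hz, hz₁, hz₂] at h1 h2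
    · simp only [additionDefect]
      linear_combination h1
    · simpa [additionDefect_swap _ 0 1] using h01 z z₂ z₁ hz hz₂ hz₁ hne₂ hne₁
    · simp only [additionDefect]
      linear_combination -h2
  · intro h z z₁ z₂ hz hz₁ hz₂ hne₁ hne₂
    have h' (i j) := h i j z z₁ z₂ hz hz₁ hz₂ hne₁ hne₂
    simp only [additionDefect] at h'
    simp only [vertexD_vertexD_sub hΦ _ _, vertexD_vertexD hΦ, hz, hz₁, hz₂]
    exact ⟨by linear_combination h' 0 0, by linear_combination -h' 1 1,
      by linear_combination h' 0 1⟩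

lemma heavenlyHierarchy_iff : HeavenlyHierarchy Φ t ↔
    ∀ i j a b c, hierarchyDefect (fderiv ℂ (fderiv ℂ Φ) t) i j a b c = 0 := by
  simp only [HeavenlyHierarchy, second_pd hΦ, hierarchyDefect, sub_eq_zero]

/-- The addition formulae are equivalent to the heavenly hierarchy. -/
theorem additionFormulae_iff_heavenlyHierarchy : AdditionFormulae Φ t ↔ HeavenlyHierarchy Φ t := by
  rw [additionFormulae_iff hΦ, heavenlyHierarchy_iff hΦ]
  exact forall₂_congr fun i j => additionDefect_eq_zero_iff _ i j (second_fderiv_symm hΦ)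

/-- Splitting off the first term of each `geomVec` in the linear part leaves two mixed `x`, `y`
derivatives, which cancel by symmetry; hence the second factor `z⁻¹`. -/
lemma generating_eq {z : ℂ} (hz : 1 < ‖z‖) :
    generating Φ z t = -z⁻¹ ^ 2 * hierarchyGen (fderiv ℂ (fderiv ℂ Φ) t) 1 0 z⁻¹ 0 0 := by
  have hs := second_fderiv_symm hΦ
  simp only [generating, bracket, pd_vertexD hΦ, vertexD_pd hΦ, hz, hierarchyGen, vertexVec,
    map_smul, smul_eq_mul, smul_apply]
  rw [geomVec_eq 1 0 (norm_inv_lt_one hz), geomVec_eq 0 0 (norm_inv_lt_one hz)]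
  simp only [map_add, map_smul, smul_eq_mul, add_apply,
    smul_apply, hs (geomVec _ _ _) (unitTime _ _), zero_add]
  rw [hs (unitTime 1 0) (unitTime 0 0)]
  ring

lemma generating_eq_zero (h : HeavenlyHierarchy Φ t) {z : ℂ} (hz : 1 < ‖z‖) :
    generating Φ z t = 0 := by
  rw [generating_eq hΦ hz, (hasSum_hierarchyGen _ 1 0 (norm_inv_lt_one hz) 0 0).unique
    (a₂ := 0) (by simp [(heavenlyHierarchy_iff hΦ).1 h, hasSum_zero]), mul_zero]

lemma heavenly_eq : heavenly Φ t = hierarchyDefect (fderiv ℂ (fderiv ℂ Φ) t) 1 0 0 0 0 := by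
  have hs := second_fderiv_symm hΦ
  simp only [heavenly, second_pd hΦ, hierarchyDefect, Finset.Nat.antidiagonal_zero,
    Finset.sum_singleton, zero_add]
  rw [hs (unitTime 0 0) (unitTime 1 1), hs (unitTime 0 0) (unitTime 1 0)]
  ring

/-- The second heavenly equation is the leading order of its generating equation. -/
theorem tendsto_generating :
    Tendsto (fun z : ℂ => z ^ 2 * generating Φ z t) (Bornology.cobounded ℂ)
      (𝓝 (-heavenly Φ t)) := by
  set H := fderiv ℂ (fderiv ℂ Φ) t with hH
  have hinv : Tendsto (fun z : ℂ => z⁻¹) (Bornology.cobounded ℂ) (𝓝 0) :=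
    tendsto_inv₀_cobounded
  have hlim : Tendsto (fun w => -hierarchyGen H 1 0 w 0 0) (𝓝 0) (𝓝 (-heavenly Φ t)) := by
    have hg := tendsto_geomVec
    have h1 (u : Times) (i : Fin 2) (a : ℕ) := ((H u).continuous.tendsto _).comp (hg i a)
    have h2 (u : Times) (i : Fin 2) (a : ℕ) := ((H.flip u).continuous.tendsto _).comp (hg i a)
    have h3 := ((h1 (unitTime 1 0) 0 1).sub (h2 (unitTime 0 0) 1 1)).sub
      (((h1 (unitTime 1 0) 0 0).mul (h1 (unitTime 0 0) 1 0)).sub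
        ((h1 (unitTime 1 0) 1 0).mul (h1 (unitTime 0 0) 0 0)))
    rw [heavenly_eq hΦ]
    refine (h3.congr fun w => ?_).neg.trans_eq ?_
    · simp [hierarchyGen]
    · simp [hierarchyDefect, H]
  refine (hlim.comp hinv).congr' ?_
  filter_upwards [(tendsto_norm_cobounded_atTop (E := ℂ)).eventually_gt_atTop 1] with z hz
  have hz0 : z ≠ 0 := norm_pos_iff.1 (one_pos.trans hz)
  rw [generating_eq hΦ hz]
  simp only [Function.comp_apply, ← hH]
  field_simp

end SecondDerivative

/-! ### The boundary data -/

lemma summable_norm_timeSeq (u : TimeSeq) : Summable fun n => ‖u n‖ := by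
  simpa using (lp.memℓp u).summable (by norm_num)

lemma tsum_norm_timeSeq (u : TimeSeq) : ∑' n, ‖u n‖ = ‖u‖ := by
  simp [lp.norm_eq_tsum_rpow (p := 1) (by norm_num) u]

lemma norm_bdry_term_le (u : TimeSeq) {z : ℂ} (hz : ‖z‖ ≤ 1) (n : ℕ) : ‖u n * z ^ n‖ ≤ ‖u n‖ := by
  rw [norm_mul, norm_pow]
  exact mul_le_of_le_one_right (norm_nonneg _) (pow_le_one₀ (norm_nonneg _) hz)

lemma hasSum_bdry (u : TimeSeq) {z : ℂ} (hz : ‖z‖ ≤ 1) :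
    HasSum (fun n => u n * z ^ n) (bdry u z) :=
  (Summable.of_norm_bounded (summable_norm_timeSeq u) (norm_bdry_term_le u hz)).hasSum

lemma norm_bdry_le (u : TimeSeq) {z : ℂ} (hz : ‖z‖ ≤ 1) : ‖bdry u z‖ ≤ ‖u‖ :=
  tsum_of_norm_bounded (tsum_norm_timeSeq u ▸ (summable_norm_timeSeq u).hasSum)
    (norm_bdry_term_le u hz)

lemma bdry_add (u v : TimeSeq) {z : ℂ} (hz : ‖z‖ ≤ 1) : bdry (u + v) z = bdry u z + bdry v z :=
  (hasSum_bdry (u + v) hz).unique (((hasSum_bdry u hz).add (hasSum_bdry v hz)).congr_fun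
    fun n => by simp [add_mul])

lemma bdry_smul (c : ℂ) (u : TimeSeq) (z : ℂ) : bdry (c • u) z = c * bdry u z := by
  rw [bdry, bdry, ← tsum_mul_left]
  simp [mul_assoc]

/-- Evaluation of the boundary datum at a point of the closed unit disc. -/
def bdryCLM {z : ℂ} (hz : ‖z‖ ≤ 1) : TimeSeq →L[ℂ] ℂ :=
  LinearMap.mkContinuous
    { toFun u := bdry u z
      map_add' u v := bdry_add u v hz
      map_smul' c u := bdry_smul c u z }
    1 fun u => by simpa using norm_bdry_le u hz

lemma bdry_single (n : ℕ) (z : ℂ) : bdry (lp.single 1 n (1 : ℂ)) z = z ^ n := by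
  rw [bdry, tsum_eq_single n]
  · simp
  · intro m hm
    simp [hm]

lemma continuousOn_bdry (u : TimeSeq) : ContinuousOn (bdry u) (Metric.closedBall 0 1) :=
  continuousOn_tsum (fun n => by fun_prop) (summable_norm_timeSeq u)
    fun n z hz => norm_bdry_term_le u (by simpa using hz) n

lemma differentiableOn_bdry (u : TimeSeq) : DifferentiableOn ℂ (bdry u) (Metric.ball 0 1) :=
  Complex.differentiableOn_tsum_of_summable_norm (summable_norm_timeSeq u) (fun n => by fun_prop)
    Metric.isOpen_ball fun n z hz => norm_bdry_term_le u (mem_ball_zero_iff.1 hz).le n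

/-! ### Contour integrals over the unit circle -/

/-- `(2πi)⁻¹ ∮ g(z) dz` over the unit circle. -/
def contour (g : ℂ → ℂ) : ℂ := (2 * Real.pi * Complex.I)⁻¹ * ∮ z in C(0, 1), g z

/-- The moment `(2πi)⁻¹ ∮ f(z) z^n dz`. -/
def moment (n : ℕ) (f : ℂ → ℂ) : ℂ := contour fun z => f z * z ^ n

section Contour

variable {f g : ℂ → ℂ}

lemma contour_add (hf : ContinuousOn f (Metric.sphere 0 1))
    (hg : ContinuousOn g (Metric.sphere 0 1)) :
    contour (fun z => f z + g z) = contour f + contour g := by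
  rw [contour, contour, contour, circleIntegral.integral_add
    (hf.circleIntegrable zero_le_one) (hg.circleIntegrable zero_le_one), mul_add]

lemma contour_sub (hf : ContinuousOn f (Metric.sphere 0 1))
    (hg : ContinuousOn g (Metric.sphere 0 1)) :
    contour (fun z => f z - g z) = contour f - contour g := by
  rw [contour, contour, contour, circleIntegral.integral_sub
    (hf.circleIntegrable zero_le_one) (hg.circleIntegrable zero_le_one), mul_sub]

lemma contour_const_mul (c : ℂ) (g : ℂ → ℂ) : contour (fun z => c * g z) = c * contour g := by
  rw [contour, contour, circleIntegral.integral_const_mul, mul_left_comm]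

lemma contour_congr (h : Set.EqOn f g (Metric.sphere 0 1)) : contour f = contour g := by
  rw [contour, contour, circleIntegral.integral_congr zero_le_one h]

lemma norm_contour_le {C : ℝ} (h : ∀ z ∈ Metric.sphere (0 : ℂ) 1, ‖f z‖ ≤ C) :
    ‖contour f‖ ≤ C := by
  simpa [contour] using
    circleIntegral.norm_two_pi_i_inv_smul_integral_le_of_norm_le_const zero_le_one h

lemma contour_eq_zero (hc : ContinuousOn f (Metric.closedBall 0 1))
    (hd : DifferentiableOn ℂ f (Metric.ball 0 1)) : contour f = 0 := by
  rw [contour, Complex.circleIntegral_eq_zero_of_differentiable_on_off_countable zero_le_one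
    Set.countable_empty hc fun z hz => hd.differentiableAt (Metric.isOpen_ball.mem_nhds hz.1),
    mul_zero]

/-- Under `z = w⁻¹` the sign of `dz = -dw / w²` cancels against the reversed orientation of the
circle. -/
lemma contour_inv (g : ℂ → ℂ) : contour g = contour fun w => (w ^ 2)⁻¹ * g w⁻¹ := by
  rw [contour, contour]
  congr 1
  set G : ℝ → ℂ := fun θ => deriv (circleMap 0 1) θ • g (circleMap 0 1 θ) with hG
  have hper : Function.Periodic G (2 * Real.pi) := fun θ => by
    simp only [hG, deriv_circleMap, periodic_circleMap 0 1 θ]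
  have h1 : (∮ w in C(0, 1), (w ^ 2)⁻¹ * g w⁻¹) = ∫ θ in (0)..(2 * Real.pi), G (-θ) := by
    refine intervalIntegral.integral_congr fun θ _ => ?_
    have h2 : circleMap 0 1 (-θ) = (circleMap 0 1 θ)⁻¹ := by
      simp [circleMap, Complex.exp_neg]
    have h3 : circleMap 0 1 θ ≠ 0 := circleMap_ne_center one_ne_zero
    simp only [hG, deriv_circleMap, h2, smul_eq_mul]
    field_simp
  rw [h1, intervalIntegral.integral_comp_neg, neg_zero]
  have h4 := hper.intervalIntegral_add_eq (-(2 * Real.pi)) 0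
  simp only [neg_add_cancel, zero_add] at h4
  rw [h4]
  rfl

end Contour

/-! ### Functions analytic outside the unit disc -/

/-- The continuous functions vanishing at infinity that are analytic outside the closed disc. -/
def exterior : Submodule ℂ C₀(ℂ, ℂ) where
  carrier := {f | DifferentiableOn ℂ f {z : ℂ | 1 < ‖z‖}}
  add_mem' hf hg := by simpa using DifferentiableOn.add hf hg
  zero_mem' := by simp
  smul_mem' c f hf := by simpa using DifferentiableOn.const_smul hf c

lemma mem_exterior {f : C₀(ℂ, ℂ)} :
    f ∈ exterior ↔ DifferentiableOn ℂ f {z : ℂ | 1 < ‖z‖} := Iff.rfl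

lemma isOpen_outside : IsOpen {z : ℂ | 1 < ‖z‖} := isOpen_lt continuous_const continuous_norm

/-- Weierstrass: uniform limits of analytic functions are analytic. Closedness lets time derivatives
of the corrections stay in `exterior`. -/
lemma isClosed_exterior : IsClosed (exterior : Set C₀(ℂ, ℂ)) := by
  refine isClosed_of_closure_subset fun f hf => ?_
  obtain ⟨u, hu, hlim⟩ := mem_closure_iff_seq_limit.1 hf
  have h1 := (ZeroAtInftyContinuousMap.tendsto_iff_tendstoUniformly.1 hlim).tendstoUniformlyOn
    (s := {z : ℂ | 1 < ‖z‖})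
  exact h1.tendstoLocallyUniformlyOn.differentiableOn (Eventually.of_forall hu) isOpen_outside

lemma mul_mem_exterior {f g : C₀(ℂ, ℂ)} (hf : f ∈ exterior) (hg : g ∈ exterior) :
    f * g ∈ exterior := by
  rw [mem_exterior] at *
  simpa using hf.mul hg

/-- The Laurent expansion at infinity. -/
lemma hasSum_moment {f : C₀(ℂ, ℂ)} (hf : f ∈ exterior) {w : ℂ} (hw0 : w ≠ 0) (hw : ‖w‖ < 1) :
    HasSum (fun n => w ^ (n + 1) * moment n f) (f w⁻¹) := by
  -- Since `f` vanishes at infinity, `F` is continuous at `0`, and the singularity there is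
  -- removable. Continuity up to the circle permits Cauchy's expansion with radius exactly `1`.
  set F : ℂ → ℂ := Function.update (fun w => f w⁻¹) 0 0 with hF
  have hFne : ∀ w ≠ 0, F w = f w⁻¹ := fun w hw => by simp [hF, hw]
  have hFev : ∀ w ≠ 0, F =ᶠ[𝓝 w] fun w => f w⁻¹ := fun w hw => by
    filter_upwards [eventually_ne_nhds hw] with v hv using hFne v hv
  have hcont : Continuous F := by
    rw [continuous_iff_continuousAt]
    intro w
    rcases eq_or_ne w 0 with rfl | hw
    · rw [hF, continuousAt_update_same]
      have h1 : Tendsto f (Bornology.cobounded ℂ) (𝓝 0) := by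
        rw [Metric.cobounded_eq_cocompact]; exact zero_at_infty f
      exact h1.comp tendsto_inv₀_nhdsNE_zero
    · exact ((map_continuous f).continuousAt.comp (continuousAt_inv₀ hw)).congr (hFev w hw).symm
  have hdiff : ∀ w ∈ Metric.ball (0 : ℂ) (1 : NNReal) \ {0}, DifferentiableAt ℂ F w := by
    rintro w ⟨hw, hw0⟩
    have hw0 : w ≠ 0 := hw0
    have h1 : 1 < ‖w⁻¹‖ := by
      rw [norm_inv]; exact (one_lt_inv₀ (norm_pos_iff.2 hw0)).2 (by simpa using hw)
    refine DifferentiableAt.congr_of_eventuallyEq ?_ (hFev w hw0)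
    exact (hf.differentiableAt (isOpen_outside.mem_nhds h1)).comp w (differentiableAt_inv hw0)
  have hps := Complex.hasFPowerSeriesOnBall_of_differentiable_off_countable
    (Set.countable_singleton (0 : ℂ)) hcont.continuousOn hdiff one_pos
  -- The coefficient of index `n + 1` is the integral of `F z / z^(n + 2)`, which inversion turns
  -- into the moment of index `n`.
  have hcoeff : ∀ n, (cauchyPowerSeries F 0 (1 : NNReal) (n + 1) fun _ => w)
      = w ^ (n + 1) * moment n f := by
    intro n
    have h1 : (cauchyPowerSeries F 0 (1 : NNReal) (n + 1) fun _ => w)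
        = contour fun z => w ^ (n + 1) * (z⁻¹ ^ (n + 2) * F z) := by
      rw [cauchyPowerSeries_apply, contour, smul_eq_mul]
      congr 2
      funext z
      simp only [sub_zero, smul_eq_mul, div_eq_mul_inv]
      ring
    rw [h1, contour_const_mul, moment, contour_inv fun z => f z * z ^ n]
    congr 1
    refine contour_congr fun z hz => ?_
    have hz0 : z ≠ 0 := by rintro rfl; simp at hz
    simp only [hFne z hz0]
    rw [inv_pow, inv_pow]
    field_simp
    ring
  have h0 : (cauchyPowerSeries F 0 (1 : NNReal) 0 fun _ => w) = 0 := by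
    rw [show (fun _ : Fin 0 => w) = 0 from Subsingleton.elim _ _, hps.coeff_zero]
    simp [hF]
  have h2 := hps.hasSum (y := w) (by
    have : ‖w‖₊ < 1 := hw
    simpa [enorm_eq_nnnorm] using this)
  rw [zero_add, hFne w hw0] at h2
  have h3 := (hasSum_nat_add_iff' 1).2 h2
  rw [Finset.sum_range_one, h0, sub_zero] at h3
  exact h3.congr_fun fun n => (hcoeff n).symm

/-- The moments of `f` are the coefficients of `w⁻¹ f(w⁻¹)`. For a product, `w⁻¹ (f g)(w⁻¹)` is `w`
times the product of the two series, which shifts the convolution by one index. -/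
lemma moment_mul {f g : C₀(ℂ, ℂ)} (hf : f ∈ exterior) (hg : g ∈ exterior) :
    moment 0 (f * g : C₀(ℂ, ℂ)) = 0 ∧ ∀ b, moment (b + 1) (f * g : C₀(ℂ, ℂ)) =
      ∑ pq ∈ Finset.HasAntidiagonal.antidiagonal b, moment pq.1 f * moment pq.2 g := by
  obtain ⟨α, hα0, hα1⟩ : ∃ α : ℕ → ℂ, α 0 = 0 ∧ ∀ b, α (b + 1) =
      ∑ pq ∈ Finset.HasAntidiagonal.antidiagonal b, moment pq.1 f * moment pq.2 g :=
    ⟨fun n => Nat.casesOn n 0 fun b =>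
      ∑ pq ∈ Finset.HasAntidiagonal.antidiagonal b, moment pq.1 f * moment pq.2 g,
      rfl, fun _ => rfl⟩
  have key : ∀ n, moment n (f * g : C₀(ℂ, ℂ)) - α n = 0 := by
    refine eq_zero_of_hasSum_pow (eventually_nhdsNE_of_unit_disc (w := 2) two_ne_zero
      fun w hw0 hw _ => ?_)
    have e : ∀ {h : C₀(ℂ, ℂ)}, h ∈ exterior →
        HasSum (fun n => w ^ n * moment n h) (w⁻¹ * h w⁻¹) := fun hh =>
      ((hasSum_moment hh hw0 hw).mul_left w⁻¹).congr_fun fun n => by rw [pow_succ']; field_simp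
    have h1 := e (mul_mem_exterior hf hg)
    have h2 := (hasSum_pow_mul_antidiagonal (e hf) (e hg)).mul_left w
    have h3 : HasSum (fun n => w ^ n * α n) (w * (w⁻¹ * f w⁻¹ * (w⁻¹ * g w⁻¹))) := by
      rw [← hasSum_nat_add_iff' 1]
      simp only [Finset.sum_range_one, hα0, hα1, mul_zero, sub_zero]
      exact h2.congr_fun fun n => by ring
    have h4 : w * (w⁻¹ * f w⁻¹ * (w⁻¹ * g w⁻¹)) = w⁻¹ * (f * g) w⁻¹ := by
      rw [ZeroAtInftyContinuousMap.mul_apply]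
      field_simp
    rw [h4] at h3
    simpa [mul_sub] using h1.sub h3
  exact ⟨by simpa [hα0] using key 0, fun b => by simpa [hα1, sub_eq_zero] using key (b + 1)⟩

/-! ### The pairing of corrections with boundary data -/

lemma continuousOn_mul_bdry (f : C₀(ℂ, ℂ)) (u : TimeSeq) :
    ContinuousOn (fun z => f z * bdry u z) (Metric.sphere 0 1) :=
  (map_continuous f).continuousOn.mul
    ((continuousOn_bdry u).mono Metric.sphere_subset_closedBall)

/-- The continuous bilinear pairing `(2πi)⁻¹ ∮ f(z) S₀(z) dz`. -/
def pairing : C₀(ℂ, ℂ) →L[ℂ] TimeSeq →L[ℂ] ℂ :=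
  LinearMap.mkContinuous₂
    (LinearMap.mk₂ ℂ (fun f u => contour fun z => f z * bdry u z)
      (fun f g u => by
        rw [← contour_add (continuousOn_mul_bdry f u) (continuousOn_mul_bdry g u)]
        simp only [ZeroAtInftyContinuousMap.add_apply, add_mul])
      (fun c f u => by
        rw [smul_eq_mul, ← contour_const_mul]
        simp only [ZeroAtInftyContinuousMap.smul_apply, smul_eq_mul, mul_assoc])
      (fun f u v => by
        rw [← contour_add (continuousOn_mul_bdry f u) (continuousOn_mul_bdry f v)]
        refine contour_congr fun z hz => ?_
        simp only [bdry_add u v (z := z) (by simp [mem_sphere_zero_iff_norm.1 hz]), mul_add])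
      (fun c f u => by
        rw [smul_eq_mul, ← contour_const_mul]
        simp only [bdry_smul, mul_left_comm]))
    1 fun f u => by
      rw [one_mul]
      refine norm_contour_le fun z hz => ?_
      rw [norm_mul]
      gcongr
      · exact (f.toBCF.norm_coe_le_norm z)
      · exact norm_bdry_le u (by simp [mem_sphere_zero_iff_norm.1 hz])

lemma pairing_apply (f : C₀(ℂ, ℂ)) (u : TimeSeq) :
    pairing f u = contour fun z => f z * bdry u z := rfl

lemma pairing_single (f : C₀(ℂ, ℂ)) (n : ℕ) : pairing f (lp.single 1 n (1 : ℂ)) = moment n f := by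
  simp only [pairing_apply, bdry_single, moment]

/-- The one-form `θ` as a continuous linear function of the pair of corrections. -/
def tauCLM : C₀(ℂ, ℂ) × C₀(ℂ, ℂ) →L[ℂ] Times →L[ℂ] ℂ :=
  ((ContinuousLinearMap.compL ℂ Times TimeSeq ℂ).flip (ContinuousLinearMap.proj 0)).comp
      (pairing.comp (ContinuousLinearMap.snd ℂ _ _))
    - ((ContinuousLinearMap.compL ℂ Times TimeSeq ℂ).flip (ContinuousLinearMap.proj 1)).comp
      (pairing.comp (ContinuousLinearMap.fst ℂ _ _))

lemma tauCLM_apply (f g : C₀(ℂ, ℂ)) (h : Times) :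
    tauCLM (f, g) h = pairing g (h 0) - pairing f (h 1) := rfl

lemma tauCLM_unitTime_zero (f g : C₀(ℂ, ℂ)) (n : ℕ) : tauCLM (f, g) (unitTime 0 n) = moment n g := by
  simp [tauCLM_apply, unitTime, pairing_single]

lemma tauCLM_unitTime_one (f g : C₀(ℂ, ℂ)) (n : ℕ) : tauCLM (f, g) (unitTime 1 n) = -moment n f := by
  simp [tauCLM_apply, unitTime, pairing_single]

lemma tauForm_eq (St : Fin 2 → Times → C₀(ℂ, ℂ)) (t h : Times) :
    tauForm St t h = tauCLM (St 0 t, St 1 t) h := by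
  rw [tauCLM_apply, pairing_apply, pairing_apply,
    ← contour_sub (continuousOn_mul_bdry _ _) (continuousOn_mul_bdry _ _)]
  rfl

/-! ### The operator `∂/∂z̄` -/

section Dbar

variable {f g : ℂ → ℂ} {z : ℂ}

lemma dbar_add (hf : DifferentiableAt ℝ f z) (hg : DifferentiableAt ℝ g z) :
    dbar (fun ζ => f ζ + g ζ) z = dbar f z + dbar g z := by
  simp only [dbar, fderiv_fun_add hf hg, add_apply]
  ring

lemma dbar_sub (hf : DifferentiableAt ℝ f z) (hg : DifferentiableAt ℝ g z) :
    dbar (fun ζ => f ζ - g ζ) z = dbar f z - dbar g z := by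
  simp only [dbar, fderiv_fun_sub hf hg, sub_apply]
  ring

lemma dbar_mul (hf : DifferentiableAt ℝ f z) (hg : DifferentiableAt ℝ g z) :
    dbar (fun ζ => f ζ * g ζ) z = f z * dbar g z + g z * dbar f z := by
  simp only [dbar, fderiv_fun_mul hf hg, add_apply, smul_apply, smul_eq_mul]
  ring

lemma dbar_eq_zero_iff (hf : DifferentiableAt ℝ f z) :
    dbar f z = 0 ↔ DifferentiableAt ℂ f z := by
  rw [differentiableAt_complex_iff_differentiableAt_real, and_iff_right hf, dbar, smul_eq_mul]
  constructor
  · intro h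
    linear_combination -2 * Complex.I * h + fderiv ℝ f z Complex.I * Complex.I_mul_I
  · intro h
    rw [h]
    linear_combination (1 / 2) * fderiv ℝ f z 1 * Complex.I_mul_I

end Dbar

/-! ### The linearized problem -/

/-- Evaluation at a point as a continuous linear functional. -/
def evalCLM (z : ℂ) : C₀(ℂ, ℂ) →L[ℂ] ℂ :=
  LinearMap.mkContinuous
    { toFun f := f z
      map_add' _ _ := rfl
      map_smul' _ _ := rfl }
    1 fun f => by simpa using f.toBCF.norm_coe_le_norm z

/-- The variation of the full function `S^i` at `t` in the direction `h`. -/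
def variation (St : Fin 2 → Times → C₀(ℂ, ℂ)) (i : Fin 2) (t h : Times) (z : ℂ) : ℂ :=
  bdry (h i) z + fderiv ℂ (St i) t h z

variable {W : ℂ → ℂ × ℂ → ℂ} {U : Set Times} {St : Fin 2 → Times → C₀(ℂ, ℂ)} {t : Times} {z : ℂ}

lemma eventually_add_smul_mem (hU : IsOpen U) (ht : t ∈ U) (h : Times) :
    ∀ᶠ s : ℝ in 𝓝 0, t + s • h ∈ U := by
  have h1 : Continuous fun s : ℝ => t + s • h := by fun_prop
  exact h1.continuousAt.eventually_mem (by simpa using hU.mem_nhds ht)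

lemma hasDerivAt_line (t h : Times) : HasDerivAt (fun s : ℝ => t + s • h) h 0 := by
  simpa using ((hasDerivAt_id (0 : ℝ)).smul_const h).const_add t

lemma differentiableAt_bdry (u : TimeSeq) (hz : z ∈ Metric.ball (0 : ℂ) 1) :
    DifferentiableAt ℂ (bdry u) z :=
  (differentiableOn_bdry u).differentiableAt (Metric.isOpen_ball.mem_nhds hz)

lemma dbar_bdry_add {f : ℂ → ℂ} (u : TimeSeq)
    (hz : z ∈ Metric.ball (0 : ℂ) 1) (hf : DifferentiableAt ℝ f z) :
    dbar (fun ζ => bdry u ζ + f ζ) z = dbar f z := by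
  have h1 := differentiableAt_bdry u hz
  rw [dbar_add (h1.restrictScalars ℝ) hf, (dbar_eq_zero_iff (h1.restrictScalars ℝ)).2 h1, zero_add]

lemma continuousOn_variation (St : Fin 2 → Times → C₀(ℂ, ℂ)) (i : Fin 2)
    (t h : Times) : ContinuousOn (variation St i t h) (Metric.closedBall 0 1) :=
  (continuousOn_bdry _).add (map_continuous _).continuousOn

namespace IsSolutionFamily

variable (hS : IsSolutionFamily W U St) (hU : IsOpen U) (ht : t ∈ U)
include hS hU ht

omit hU in
lemma hasFDerivAt (i : Fin 2) : HasFDerivAt (St i) (fderiv ℂ (St i) t) t :=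
  (hS.times i t ht).differentiableAt.hasFDerivAt

/-- The derivative is a sup-norm limit of difference quotients, which lie in the closed subspace
`exterior`. -/
lemma fderiv_mem_exterior (i : Fin 2) (h : Times) : fderiv ℂ (St i) t h ∈ exterior := by
  have h1 : HasDerivAt (fun c : ℂ => t + c • h) h 0 := by
    simpa using ((hasDerivAt_id (0 : ℂ)).smul_const h).const_add t
  have h2 : HasDerivAt (fun c : ℂ => St i (t + c • h)) (fderiv ℂ (St i) t h) 0 :=
    HasFDerivAt.comp_hasDerivAt (f := fun c : ℂ => t + c • h) 0
      (by simpa using hS.hasFDerivAt ht i) h1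
  refine isClosed_exterior.mem_of_tendsto h2.tendsto_slope_zero ?_
  have h3 : ∀ᶠ c : ℂ in 𝓝 0, t + c • h ∈ U :=
    h1.continuousAt.eventually_mem (by simpa using hU.mem_nhds ht)
  filter_upwards [h3.filter_mono nhdsWithin_le_nhds] with c hc
  refine exterior.smul_mem _ (exterior.sub_mem ?_ ?_)
  · exact hS.outside i _ (by simpa using hc)
  · exact hS.outside i _ (by simpa using ht)

omit hU in
lemma hasFDerivAt_full (i : Fin 2) (hz : ‖z‖ ≤ 1) :
    HasFDerivAt (fun s => full St i s z)
      ((bdryCLM hz).comp (ContinuousLinearMap.proj i) + (evalCLM z).comp (fderiv ℂ (St i) t)) t := by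
  have h1 : HasFDerivAt (fun s : Times => bdry (s i) z)
      ((bdryCLM hz).comp (ContinuousLinearMap.proj i)) t :=
    ((bdryCLM hz).comp (ContinuousLinearMap.proj i : Times →L[ℂ] TimeSeq)).hasFDerivAt
  have h2 : HasFDerivAt (fun s => St i s z) ((evalCLM z).comp (fderiv ℂ (St i) t)) t :=
    (evalCLM z).hasFDerivAt.comp t (hS.hasFDerivAt ht i)
  exact h1.fun_add h2

omit hU in
lemma hasDerivAt_full (i : Fin 2) (h : Times) (hz : ‖z‖ ≤ 1) :
    HasDerivAt (fun s : ℝ => full St i (t + s • h) z) (variation St i t h z) 0 := by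
  have h1 := (hS.hasFDerivAt_full ht i hz).restrictScalars ℝ
  have h2 : t = t + (0 : ℝ) • h := by simp
  rw [h2] at h1
  have h3 := HasFDerivAt.comp_hasDerivAt (f := fun s : ℝ => t + s • h) 0 h1 (hasDerivAt_line t h)
  rw [← h2] at h3
  exact h3

lemma contDiffAt_uncurry (i : Fin 2) (hz : z ∈ Metric.ball (0 : ℂ) 1) :
    ContDiffAt ℝ 2 (fun p : ℂ × Times => St i p.2 p.1) (z, t) :=
  (hS.smooth i).contDiffAt ((Metric.isOpen_ball.prod hU).mem_nhds ⟨hz, ht⟩)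

lemma hasFDerivAt_space (i : Fin 2) (hz : z ∈ Metric.ball (0 : ℂ) 1) :
    HasFDerivAt (𝕜 := ℝ) (St i t)
      ((fderiv ℝ (fun p : ℂ × Times => St i p.2 p.1) (z, t)).comp
        (ContinuousLinearMap.inl ℝ ℂ Times)) z := by
  have h1 := ((hS.contDiffAt_uncurry hU ht i hz).differentiableAt (by norm_num)).hasFDerivAt
  exact h1.comp z (hasFDerivAt_prodMk_left (𝕜 := ℝ) z t)

lemma fderiv_uncurry_inr (i : Fin 2) (hz : z ∈ Metric.ball (0 : ℂ) 1) (h : Times) :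
    fderiv ℝ (fun p : ℂ × Times => St i p.2 p.1) (z, t) (0, h) = fderiv ℂ (St i) t h z := by
  have h1 := ((hS.contDiffAt_uncurry hU ht i hz).differentiableAt (by norm_num)).hasFDerivAt
  have h2 := h1.comp t (hasFDerivAt_prodMk_right z t)
  have h3 : HasFDerivAt (fun s => St i s z) ((evalCLM z).comp (fderiv ℂ (St i) t)) t :=
    (evalCLM z).hasFDerivAt.comp t (hS.hasFDerivAt ht i)
  exact DFunLike.congr_fun (h2.unique (h3.restrictScalars ℝ)) h

/-- The variation of the correction in the times is differentiable in `z`, and its derivative is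
the variation of the derivative. -/
lemma mixed_partials (i : Fin 2) (hz : z ∈ Metric.ball (0 : ℂ) 1) (h : Times) :
    DifferentiableAt ℝ (fderiv ℂ (St i) t h) z ∧ ∀ v : ℂ,
      HasDerivAt (fun s : ℝ => fderiv ℝ (St i (t + s • h)) z v)
        (fderiv ℝ (fderiv ℂ (St i) t h) z v) 0 := by
  set g : ℂ × Times → ℂ := fun p => St i p.2 p.1 with hg
  have hC := hS.contDiffAt_uncurry hU ht i hz
  have hD : HasFDerivAt (fderiv ℝ g) (fderiv ℝ (fderiv ℝ g) (z, t)) (z, t) :=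
    ((hC.fderiv_right (m := 1) (by norm_num)).differentiableAt (by norm_num)).hasFDerivAt
  have happ (u : ℂ × Times) := (ContinuousLinearMap.apply ℝ ℂ u).hasFDerivAt.comp (z, t) hD
  have h1 : HasFDerivAt (𝕜 := ℝ) (fderiv ℂ (St i) t h)
      (((fderiv ℝ (fderiv ℝ g) (z, t)).flip (0, h)).comp (ContinuousLinearMap.inl ℝ ℂ Times)) z := by
    refine ((happ (0, h)).comp z (hasFDerivAt_prodMk_left z t)).congr_of_eventuallyEq ?_
    filter_upwards [Metric.isOpen_ball.mem_nhds hz] with ζ hζ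
    exact (hS.fderiv_uncurry_inr hU ht i hζ h).symm
  refine ⟨h1.differentiableAt, fun v => ?_⟩
  have h2 : HasDerivAt (fun s : ℝ => fderiv ℝ g (z, t + s • h) (v, 0))
      (fderiv ℝ (fderiv ℝ g) (z, t) (0, h) (v, 0)) 0 := by
    have h3 : HasDerivAt (fun s : ℝ => (z, t + s • h)) ((0 : ℂ), h) 0 :=
      (hasDerivAt_const _ z).prodMk (hasDerivAt_line t h)
    exact HasFDerivAt.comp_hasDerivAt (f := fun s : ℝ => (z, t + s • h)) 0
      (by simpa using happ (v, 0)) h3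
  rw [h1.fderiv]
  -- The joint `C²` hypothesis enters here: derivatives in `z` and in `t` commute.
  have hsymm : fderiv ℝ (fderiv ℝ g) (z, t) (0, h) (v, 0)
      = fderiv ℝ (fderiv ℝ g) (z, t) (v, 0) (0, h) := hC.isSymmSndFDerivAt (by simp) _ _
  rw [hsymm] at h2
  refine h2.congr_of_eventuallyEq ?_
  filter_upwards [eventually_add_smul_mem hU ht h] with s hs
  rw [(hS.hasFDerivAt_space hU hs i hz).fderiv]
  rfl

lemma differentiableAt_variation (i : Fin 2) (hz : z ∈ Metric.ball (0 : ℂ) 1) (h : Times) :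
    DifferentiableAt ℝ (variation St i t h) z :=
  ((differentiableAt_bdry (h i) hz).restrictScalars ℝ).add (hS.mixed_partials hU ht i hz h).1

lemma hasDerivAt_dbar_full (i : Fin 2) (hz : z ∈ Metric.ball (0 : ℂ) 1) (h : Times) :
    HasDerivAt (fun s : ℝ => dbar (full St i (t + s • h)) z) (dbar (variation St i t h) z) 0 := by
  obtain ⟨h1, h2⟩ := hS.mixed_partials hU ht i hz h
  have h3 : dbar (variation St i t h) z = dbar (fderiv ℂ (St i) t h) z :=
    dbar_bdry_add (h i) hz h1
  rw [h3]
  refine (((h2 1).add ((h2 Complex.I).const_mul Complex.I)).const_mul (1 / 2 : ℂ)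
    ).congr_of_eventuallyEq ?_
  filter_upwards [eventually_add_smul_mem hU ht h] with s hs
  exact dbar_bdry_add _ hz (hS.hasFDerivAt_space hU hs i hz).differentiableAt

omit hU in
lemma hasDerivAt_fderiv_potential (hz : z ∈ Metric.ball (0 : ℂ) 1) (h : Times) (u : ℂ × ℂ) :
    HasDerivAt
      (fun s : ℝ => fderiv ℂ (W z) (full St 0 (t + s • h) z, full St 1 (t + s • h) z) u)
      (fderiv ℂ (fderiv ℂ (W z)) (full St 0 t z, full St 1 t z)
        (variation St 0 t h z, variation St 1 t h z) u) 0 := by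
  have hz' : ‖z‖ ≤ 1 := (mem_ball_zero_iff.1 hz).le
  have h1 := (hS.hasDerivAt_full ht 0 h hz').prodMk (hS.hasDerivAt_full ht 1 h hz')
  have h2 := ((hS.potential t ht z hz).fderiv.differentiableAt.hasFDerivAt)
  have h3 := ((ContinuousLinearMap.apply ℂ ℂ u).hasFDerivAt.comp _ h2).restrictScalars ℝ
  exact HasFDerivAt.comp_hasDerivAt
    (f := fun s : ℝ => (full St 0 (t + s • h) z, full St 1 (t + s • h) z)) 0 (by simpa using h3) h1

/-- The linearization of the first equation. -/
lemma dbar_variation_zero (hz : z ∈ Metric.ball (0 : ℂ) 1) (h : Times) :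
    dbar (variation St 0 t h) z = fderiv ℂ (fderiv ℂ (W z)) (full St 0 t z, full St 1 t z)
      (variation St 0 t h z, variation St 1 t h z) (0, 1) := by
  refine (hS.hasDerivAt_dbar_full hU ht 0 hz h).unique
    ((hS.hasDerivAt_fderiv_potential ht hz h (0, 1)).congr_of_eventuallyEq ?_)
  filter_upwards [eventually_add_smul_mem hU ht h] with s hs using hS.eq_one _ hs z hz

/-- The linearization of the second equation. -/
lemma dbar_variation_one (hz : z ∈ Metric.ball (0 : ℂ) 1) (h : Times) :
    dbar (variation St 1 t h) z = -fderiv ℂ (fderiv ℂ (W z)) (full St 0 t z, full St 1 t z)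
      (variation St 0 t h z, variation St 1 t h z) (1, 0) := by
  refine (hS.hasDerivAt_dbar_full hU ht 1 hz h).unique
    ((hS.hasDerivAt_fderiv_potential ht hz h (1, 0)).neg.congr_of_eventuallyEq ?_)
  filter_upwards [eventually_add_smul_mem hU ht h] with s hs using hS.eq_two _ hs z hz

/-- The symplectic product of two variations is analytic in the unit disc. -/
lemma differentiableAt_symplectic (hz : z ∈ Metric.ball (0 : ℂ) 1) (h k : Times) :
    DifferentiableAt ℂ (fun z => variation St 0 t h z * variation St 1 t k z
      - variation St 1 t h z * variation St 0 t k z) z := by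
  have hd (i h) := hS.differentiableAt_variation hU ht i hz h
  rw [← dbar_eq_zero_iff (((hd 0 h).fun_mul (hd 1 k)).fun_sub ((hd 1 h).fun_mul (hd 0 k))),
    dbar_sub ((hd 0 h).fun_mul (hd 1 k)) ((hd 1 h).fun_mul (hd 0 k)), dbar_mul (hd 0 h) (hd 1 k),
    dbar_mul (hd 1 h) (hd 0 k)]
  simp only [hS.dbar_variation_zero hU ht hz, hS.dbar_variation_one hU ht hz]
  set Q := fderiv ℂ (fderiv ℂ (W z)) (full St 0 t z, full St 1 t z) with hQ
  have hsymm : ∀ u v, Q u v = Q v u :=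
    ((hS.potential t ht z hz).contDiffAt (n := 2)).isSymmSndFDerivAt (by simp)
  have hlin (v : ℂ × ℂ) (a b : ℂ) : Q v (a, b) = a * Q v (1, 0) + b * Q v (0, 1) := by
    rw [← smul_eq_mul, ← smul_eq_mul, ← map_smul, ← map_smul, ← map_add]
    simp
  -- With `v_h`, `v_k` the two variations, the `∂̄`-derivative is `Q v_h v_k - Q v_k v_h`, zero by
  -- symmetry of the Hessian.
  linear_combination hsymm (variation St 0 t h z, variation St 1 t h z)
      (variation St 0 t k z, variation St 1 t k z)
    - hlin (variation St 0 t h z, variation St 1 t h z)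
      (variation St 0 t k z) (variation St 1 t k z)
    + hlin (variation St 0 t k z, variation St 1 t k z)
      (variation St 0 t h z) (variation St 1 t h z)

/-- The bilinear relation between the variations of the corrections. Here `h'` and `k'` are `h` and
`k` with the boundary data multiplied by `z^m`. -/
lemma bilinear_relation (m : ℕ) (h k h' k' : Times)
    (hh : ∀ i z, bdry (h' i) z = bdry (h i) z * z ^ m)
    (hk : ∀ i z, bdry (k' i) z = bdry (k i) z * z ^ m) :
    tauCLM (fderiv ℂ (St 0) t k, fderiv ℂ (St 1) t k) h'
      - tauCLM (fderiv ℂ (St 0) t h, fderiv ℂ (St 1) t h) k'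
      + (moment m (fderiv ℂ (St 0) t h * fderiv ℂ (St 1) t k : C₀(ℂ, ℂ))
        - moment m (fderiv ℂ (St 1) t h * fderiv ℂ (St 0) t k : C₀(ℂ, ℂ))) = 0 := by
  have hsub := Metric.sphere_subset_closedBall (x := (0 : ℂ)) (ε := 1)
  have hm : ContinuousOn (fun z : ℂ => z ^ m) (Metric.closedBall 0 1) := by fun_prop
  have hm' : DifferentiableOn ℂ (fun z : ℂ => z ^ m) (Metric.ball 0 1) := by fun_prop
  have hb (u) := continuousOn_bdry u
  have hb' (u) := differentiableOn_bdry u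
  have hv (i h) := continuousOn_variation St i t h
  have hc (f : C₀(ℂ, ℂ)) : ContinuousOn f (Metric.closedBall 0 1) := (map_continuous f).continuousOn
  have e1 : contour (fun z => (variation St 0 t h z * variation St 1 t k z
      - variation St 1 t h z * variation St 0 t k z) * z ^ m) = 0 :=
    contour_eq_zero ((((hv 0 h).mul (hv 1 k)).sub ((hv 1 h).mul (hv 0 k))).mul hm)
      (DifferentiableOn.mul (fun z hz =>
        (hS.differentiableAt_symplectic hU ht hz h k).differentiableWithinAt) hm')
  have e2 : contour (fun z => (bdry (h 0) z * bdry (k 1) z - bdry (h 1) z * bdry (k 0) z) * z ^ m)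
      = 0 :=
    contour_eq_zero ((((hb (h 0)).mul (hb (k 1))).sub ((hb (h 1)).mul (hb (k 0)))).mul hm)
      ((((hb' (h 0)).mul (hb' (k 1))).sub ((hb' (h 1)).mul (hb' (k 0)))).mul hm')
  simp only [tauCLM_apply, pairing_apply, moment, ZeroAtInftyContinuousMap.mul_apply, hh, hk]
  have hbm (f : C₀(ℂ, ℂ)) (u : TimeSeq) :
      ContinuousOn (fun z => f z * (bdry u z * z ^ m)) (Metric.sphere 0 1) :=
    ((hc f).mul ((hb u).mul hm)).mono hsub
  have hfg (f g : C₀(ℂ, ℂ)) : ContinuousOn (fun z => f z * g z * z ^ m) (Metric.sphere 0 1) :=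
    (((hc f).mul (hc g)).mul hm).mono hsub
  have hbs (f g : C₀(ℂ, ℂ)) (u v : TimeSeq) := (hbm f u).fun_sub (hbm g v)
  have hbb := ((((hb (h 0)).fun_mul (hb (k 1))).fun_sub
    ((hb (h 1)).fun_mul (hb (k 0)))).fun_mul hm).mono hsub
  -- All terms are merged into one integral. Adding the vanishing boundary part `e2` completes the
  -- integrand to that of `e1`.
  rw [← contour_sub (hbm _ _) (hbm _ _), ← contour_sub (hbm _ _) (hbm _ _),
    ← contour_sub (hfg _ _) (hfg _ _),
    ← contour_sub (hbs _ _ _ _) (hbs _ _ _ _),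
    ← contour_add ((hbs _ _ _ _).fun_sub (hbs _ _ _ _))
      ((hfg _ _).fun_sub (hfg _ _)), ← add_zero (contour _)]
  nth_rewrite 1 [← e2]
  rw [← contour_add (((hbs _ _ _ _).fun_sub (hbs _ _ _ _)).fun_add
      ((hfg _ _).fun_sub (hfg _ _))) hbb, ← e1]
  congr 1
  funext z
  simp only [variation]
  ring

/-! ### The one-form and its primitives -/

omit hU in
lemma hasFDerivAt_tau : HasFDerivAt (fun s => tauCLM (St 0 s, St 1 s))
    (tauCLM.comp ((fderiv ℂ (St 0) t).prod (fderiv ℂ (St 1) t))) t :=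
  tauCLM.hasFDerivAt.comp t ((hS.hasFDerivAt ht 0).prodMk (hS.hasFDerivAt ht 1))

/-- The one-form `θ` is closed. -/
lemma fderiv_tau_symm (h k : Times) :
    fderiv ℂ (fun s => tauCLM (St 0 s, St 1 s)) t h k
      = fderiv ℂ (fun s => tauCLM (St 0 s, St 1 s)) t k h := by
  have h1 := hS.bilinear_relation hU ht 0 h k h k (by simp) (by simp)
  have hL (i h) := hS.fderiv_mem_exterior hU ht i h
  -- With `m = 0` the quadratic terms are zeroth moments of products, which vanish.
  rw [(moment_mul (hL 0 h) (hL 1 k)).1, (moment_mul (hL 1 h) (hL 0 k)).1, sub_zero, add_zero,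
    sub_eq_zero] at h1
  rw [(hS.hasFDerivAt_tau ht).fderiv]
  exact h1.symm

omit ht in
theorem exists_isTau (hconv : Convex ℝ U) : ∃ Θ : Times → ℂ, IsTau U St Θ := by
  have hd : DifferentiableOn ℝ (fun s => tauCLM (St 0 s, St 1 s)) U := fun s hs =>
    ((hS.hasFDerivAt_tau hs).restrictScalars ℝ).differentiableAt.differentiableWithinAt
  -- Poincaré lemma on a convex open set; closedness is checked for the real derivative, which is
  -- the restriction of the complex one.
  obtain ⟨Θ, hΘ⟩ := hconv.exists_forall_hasFDerivAt_of_fderiv_symmetric hU hd fun s hs h k => by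
    rw [(hS.hasFDerivAt_tau hs).differentiableAt.fderiv_restrictScalars ℝ]
    exact hS.fderiv_tau_symm hU hs h k
  exact ⟨Θ, fun s hs => ⟨(hΘ s hs).differentiableAt, fun h => by
    rw [(hΘ s hs).fderiv, tauForm_eq]⟩⟩

end IsSolutionFamily

/-! ### Properties of `τ`-functions -/

namespace IsTau

variable {Θ : Times → ℂ} (hΘ : IsTau U St Θ) (hS : IsSolutionFamily W U St) (hU : IsOpen U)
  (ht : t ∈ U)
include hΘ

lemma fderiv_eq (ht : t ∈ U) : fderiv ℂ Θ t = tauCLM (St 0 t, St 1 t) := by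
  ext h
  rw [(hΘ t ht).2, tauForm_eq]

include hS hU

/-- The derivative of `Θ` is a continuous linear image of the corrections, hence analytic in the
times. -/
theorem contDiffOn : ContDiffOn ℂ ∞ Θ U := by
  rw [contDiffOn_infty_iff_fderiv_of_isOpen hU]
  refine ⟨fun s hs => (hΘ s hs).1.differentiableWithinAt, ?_⟩
  have h1 : AnalyticOnNhd ℂ (fun s => tauCLM (St 0 s, St 1 s)) U :=
    tauCLM.comp_analyticOnNhd ((hS.times 0).prod (hS.times 1))
  exact (h1.contDiffOn hU.uniqueDiffOn).congr fun s hs => hΘ.fderiv_eq hs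

include ht

omit hU in
/-- The corrections are recovered from a `τ`-function by the vertex operators. -/
theorem reconstruction (hz : 1 < ‖z‖) :
    (∀ i, Summable fun n : ℕ => z⁻¹ ^ (n + 1) * pd i n Θ t) ∧
      St 0 t z = -vertexD 1 z Θ t ∧ St 1 t z = vertexD 0 z Θ t := by
  have hd := (hΘ t ht).1
  have h1 (i) := hasSum_moment (hS.outside i t ht) (inv_ne_zero (norm_pos_iff.1 (one_pos.trans hz)))
    (norm_inv_lt_one hz)
  simp only [inv_inv] at h1
  refine ⟨fun i => (hasSum_vertexD hd hz i).summable, ?_, ?_⟩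
  · rw [vertexD, ← tsum_neg, ← (h1 0).tsum_eq]
    refine tsum_congr fun n => ?_
    rw [pd_eq_fderiv hd, hΘ.fderiv_eq ht, tauCLM_unitTime_one, mul_neg, neg_neg]
  · rw [vertexD, ← (h1 1).tsum_eq]
    refine tsum_congr fun n => ?_
    rw [pd_eq_fderiv hd, hΘ.fderiv_eq ht, tauCLM_unitTime_zero]

lemma second_fderiv_eq (h k : Times) : fderiv ℂ (fderiv ℂ Θ) t h k
    = tauCLM (fderiv ℂ (St 0) t h, fderiv ℂ (St 1) t h) k := by
  have h1 : fderiv ℂ Θ =ᶠ[𝓝 t] fun s => tauCLM (St 0 s, St 1 s) := by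
    filter_upwards [hU.mem_nhds ht] with s hs using hΘ.fderiv_eq hs
  rw [h1.fderiv_eq, (hS.hasFDerivAt_tau ht).fderiv]
  rfl

lemma contDiffAt : ContDiffAt ℂ 2 Θ t :=
  (contDiffOn_infty.1 (hΘ.contDiffOn hS hU) 2).contDiffAt (hU.mem_nhds ht)

/-- The bilinear relation is applied to two unit times with `m = b + 1`: multiplying the boundary
datum `z^a` by `z^(b + 1)` moves the unit time of index `a` to index `a + b + 1`. Convolved moments
are products of second derivatives, with a minus sign from each moment of `S̃¹`. -/
theorem heavenlyHierarchy : HeavenlyHierarchy Θ t := by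
  have hC := hΘ.contDiffAt hS hU ht
  rw [heavenlyHierarchy_iff hC]
  intro i j a b c
  have hshift (i : Fin 2) (a : ℕ) (l : Fin 2) (z : ℂ) :
      bdry (unitTime i (a + (b + 1)) l) z = bdry (unitTime i a l) z * z ^ (b + 1) := by
    by_cases hl : l = i
    · subst hl
      simp only [unitTime, Pi.single_eq_same, bdry_single, pow_add]
    · simp [unitTime, Pi.single_eq_of_ne hl, bdry]
  have h1 := hS.bilinear_relation hU ht (b + 1) (unitTime i a) (unitTime j c) _ _
    (hshift i a) (hshift j c)
  have hL (i h) := hS.fderiv_mem_exterior hU ht i h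
  rw [(moment_mul (hL 0 _) (hL 1 _)).2, (moment_mul (hL 1 _) (hL 0 _)).2,
    ← Finset.sum_sub_distrib] at h1
  rw [hierarchyDefect, second_fderiv_symm hC (unitTime i (a + b + 1))]
  simp only [hΘ.second_fderiv_eq hS hU ht, tauCLM_unitTime_zero, tauCLM_unitTime_one]
  rw [show b + c + 1 = c + (b + 1) by ring, show a + b + 1 = a + (b + 1) by ring]
  have h2 : ∀ x y : ℂ, ∀ X : ℂ, x - y + X = 0 → y - x - X = 0 := fun x y X h => by
    linear_combination -h
  refine h2 _ _ _ ?_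
  rw [← h1]
  congr 1
  refine Finset.sum_congr rfl fun pq _ => ?_
  ring

end IsTau

end HeavenlyDbar

end

theorem mainTheorem4 (W : ℂ → ℂ × ℂ → ℂ) (U : Set HeavenlyDbar.Times) (hU : IsOpen U)
    (St : Fin 2 → HeavenlyDbar.Times → C₀(ℂ, ℂ))
    (hS : HeavenlyDbar.IsSolutionFamily W U St) :
    (Convex ℝ U → ∃ Θ : HeavenlyDbar.Times → ℂ, HeavenlyDbar.IsTau U St Θ) ∧
    (∀ Θ : HeavenlyDbar.Times → ℂ, HeavenlyDbar.IsTau U St Θ →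
      ContDiffOn ℂ ∞ Θ U ∧
      ∀ t ∈ U,
        (∀ z : ℂ, 1 < ‖z‖ →
          (∀ i, Summable fun n : ℕ => z⁻¹ ^ (n + 1) * HeavenlyDbar.pd i n Θ t) ∧
          St 0 t z = -HeavenlyDbar.vertexD 1 z Θ t ∧
          St 1 t z = HeavenlyDbar.vertexD 0 z Θ t) ∧
        HeavenlyDbar.AdditionFormulae Θ t ∧
        HeavenlyDbar.HeavenlyHierarchy Θ t ∧
        (∀ z : ℂ, 1 < ‖z‖ → HeavenlyDbar.generating Θ z t = 0) ∧
        HeavenlyDbar.heavenly Θ t = 0) ∧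
    (∀ (Φ : HeavenlyDbar.Times → ℂ) (t : HeavenlyDbar.Times), ContDiffAt ℂ 2 Φ t →
      (HeavenlyDbar.AdditionFormulae Φ t ↔ HeavenlyDbar.HeavenlyHierarchy Φ t) ∧
      Filter.Tendsto (fun z : ℂ => z ^ 2 * HeavenlyDbar.generating Φ z t)
        (Bornology.cobounded ℂ) (𝓝 (-HeavenlyDbar.heavenly Φ t))) := by
  open HeavenlyDbar in
  refine ⟨hS.exists_isTau hU, fun Θ hΘ => ⟨hΘ.contDiffOn hS hU, fun t ht => ?_⟩,
    fun Φ t hΦ => ⟨additionFormulae_iff_heavenlyHierarchy hΦ, tendsto_generating hΦ⟩⟩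
  have hC := hΘ.contDiffAt hS hU ht
  have hH := hΘ.heavenlyHierarchy hS hU ht
  refine ⟨fun z hz => hΘ.reconstruction hS ht hz,
    (HeavenlyDbar.additionFormulae_iff_heavenlyHierarchy hC).2 hH, hH,
    fun z hz => HeavenlyDbar.generating_eq_zero hC hH hz, ?_⟩
  rw [HeavenlyDbar.heavenly_eq hC]
  exact (HeavenlyDbar.heavenlyHierarchy_iff hC).1 hH 1 0 0 0 0
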